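/- Let $M$ be a smooth manifold of dimension $7$ without boundary. Let $\varphi_0=e^{123}+e^{145}+e^{167}+e^{246}-e^{257}-e^{347}-e^{356}$ be the standard $G_2$ form on $\mathbb R^7$, where $e^{abc}=e^a\wedge e^b\wedge e^c$ takes the value $1$ on $(e_a,e_b,e_c)$. A smooth $3$-form $\omega$ on $M$ is called \emph{positive}, $\omega\in\Omega^3_+(M)$, if for every $x\in M$ there is a linear isomorphism $f:T_xM\to\mathbb R^7$ with $\omega_x=f^*\varphi_0$; the metric it induces is $(g_\omega)_x=f^*\langle\cdot,\cdot\rangle_{\mathbb R^7}$, which does not depend on $f$. For a symmetric $2$-tensor $h$ put $i_\omega(h)_{abc}=h_{[a|i|}\,\omega^{i}{}_{bc]}$, where the index is raised with $g_\omega$ and the skew-symmetrisation carries the factor $1/3!$. For Riemannian metrics $g,k$ let $B_k^g$ be the $k$-symmetric, positive definite square root of the endomorphism $A_k^g$ of $TM$ defined by $g(X,Y)=k(A_k^gX,Y)$. Let $\omega\in\Omega^3_+(M)$ have induced metric $g$, let $I\subseteq\mathbb R$ be an interval containing $0$, and let $\{g_t\}_{t\in I}$ be a curve of Riemannian metrics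 on $M$, smooth in $(t,x)\in I\times M$, with $g_0=g$. For an interval $J$ with $0\in J\subseteq I$, a \emph{solution on $J$} is a family $\{\omega_t\}_{t\in J}$ in $\Omega^3_+(M)$, smooth in $(t,x)\in J\times M$, with $$\dot\omega_t=\tfrac32\, i_{\omega_t}(\dot g_t)\quad(t\in J),\qquad \omega_0=\omega .$$ 1. There is a solution $\{\omega_t\}_{t\in I}$ on the whole of $I$. For every $t\in I$ the form $\omega_t$ is positive and induces the metric $g_t$. It is the only solution: for every interval $J$ with $0\in J\subseteq I$, any solution on $J$ equals $\omega_t$ for all $t\in J$. 2. Suppose that at every point of $M$ $$B^{g}_{g_{t_1}}\circ B^{g}_{g_{t_2}}=B^{g}_{g_{t_2}}\circ B^{g}_{g_{t_1}}\qquad\text{for all } t_1,t_2\in I. \tag{$*$}$$ Then for every $\bar t\in I$ the form $\omega_{\bar t}$ does not depend on the path: if $\{g'_t\}_{t\in I'}$ is another smooth curve of Riemannian metrics on an interval $I'\ni 0,\bar t$ that satisfies $(*)$ on $I'$, with $g'_0=g_0$ and $g'_{\bar t}=g_{\bar t}$, then its solution $\omega'_t$ on $I'$ with $\omega'_0=\omega$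 satisfies $\omega'_{\bar t}=\omega_{\bar t}$. -/

import Mathlib

open Set
open scoped Manifold ContDiff

noncomputable section

namespace G2

/-! ### Linear algebra on a single tangent space -/

/-- The Euclidean space `ℝ⁷`. -/
abbrev E7 : Type := EuclideanSpace ℝ (Fin 7)

/-- The elementary alternating form `e^a ∧ e^b ∧ e^c` on `ℝ⁷`, normalised to take the value `1` on
`(e_a, e_b, e_c)` for distinct `a`, `b`, `c`. -/
def elemForm (a b c : Fin 7) : E7 [⋀^Fin 3]→L[ℝ] ℝ :=
  { (Matrix.detRowAlternating (R := ℝ) (n := Fin 3)).compLinearMap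
      (LinearMap.pi fun j : Fin 3 => (EuclideanSpace.proj (𝕜 := ℝ) (![a, b, c] j)).toLinearMap) with
    cont := by
      change Continuous fun v : Fin 3 → E7 => Matrix.det fun i j : Fin 3 => v i (![a, b, c] j)
      exact Continuous.matrix_det (by fun_prop) }

/-- The standard `G₂` three-form on `ℝ⁷` (indices start at `0`):
`e¹²³ + e¹⁴⁵ + e¹⁶⁷ + e²⁴⁶ - e²⁵⁷ - e³⁴⁷ - e³⁵⁶`. -/
def stdForm : E7 [⋀^Fin 3]→L[ℝ] ℝ :=
  elemForm 0 1 2 + elemForm 0 3 4 + elemForm 0 5 6 + elemForm 1 3 5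
    - elemForm 1 4 6 - elemForm 2 3 6 - elemForm 2 4 5

section LinearAlgebra

variable {V : Type*} [AddCommGroup V] [Module ℝ V] [TopologicalSpace V]

/-- `f : V ≃ ℝ⁷` is an adapted frame of the three-form `φ` if it identifies `φ` with the standard
`G₂` form. -/
def IsAdaptedFrame (φ : V [⋀^Fin 3]→L[ℝ] ℝ) (f : V ≃L[ℝ] E7) : Prop :=
  φ = stdForm.compContinuousLinearMap (f : V →L[ℝ] E7)

/-- A three-form on `V` is positive if it is `GL`-equivalent to the standard `G₂` form. -/
def IsPositive (φ : V [⋀^Fin 3]→L[ℝ] ℝ) : Prop :=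
  ∃ f : V ≃L[ℝ] E7, IsAdaptedFrame φ f

/-- `k` is the inner product compatible with the positive three-form `φ`: the pull-back of the
Euclidean inner product by an adapted frame of `φ`. (It does not depend on the frame, because the
stabiliser of the standard form in `GL(7, ℝ)` is `G₂ ⊆ SO(7)`.) -/
def IsCompatible (φ : V [⋀^Fin 3]→L[ℝ] ℝ) (k : V →L[ℝ] V →L[ℝ] ℝ) : Prop :=
  ∃ f : V ≃L[ℝ] E7, IsAdaptedFrame φ f ∧ ∀ u v, k u v = inner ℝ (f u) (f v)

/-- The inner product `g_φ` induced by a positive three-form `φ`. -/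
def inducedMetric (φ : V [⋀^Fin 3]→L[ℝ] ℝ) : V →L[ℝ] V →L[ℝ] ℝ :=
  Classical.epsilon fun k => IsCompatible φ k

/-- The endomorphism `h_a^b = h_{ai} k^{ib}` obtained from the bilinear form `h` by raising an index
with the inner product `k`, that is, `k (h^♯ u) v = h u v`. -/
def raise (k h : V →L[ℝ] V →L[ℝ] ℝ) : V →L[ℝ] V :=
  Classical.epsilon fun S => ∀ u v, k (S u) v = h u v

/-- `i_φ(h)_{abc} = h_{[a|i|} φ^i_{bc]}`: the skew-symmetrisation (with the factor `1/3!`) of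
`(u, v, w) ↦ φ (h^♯ u, v, w)`, where the index is raised with the metric `g_φ`. -/
def iMap (φ : V [⋀^Fin 3]→L[ℝ] ℝ) [IsTopologicalAddGroup V] [ContinuousConstSMul ℝ V]
    (h : V →L[ℝ] V →L[ℝ] ℝ) : V [⋀^Fin 3]→L[ℝ] ℝ :=
  (1 / 6 : ℝ) • ContinuousMultilinearMap.alternatization
    (φ.toContinuousMultilinearMap.compContinuousLinearMap fun i : Fin 3 =>
      if i = 0 then raise (inducedMetric φ) h else ContinuousLinearMap.id ℝ V)

/-- `B` is `k`-symmetric and positive definite, and `B ∘ B = A`, where `A` is the endomorphism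
with `g (u, v) = k (A u, v)`. -/
def IsMetricRoot (g k : V →L[ℝ] V →L[ℝ] ℝ) (B : V →L[ℝ] V) : Prop :=
  (∀ u v, k (B u) v = k u (B v)) ∧ (∀ u, u ≠ 0 → 0 < k (B u) u) ∧ ∀ u v, g u v = k (B (B u)) v

/-- The endomorphism `B_k^g`: the positive square root of the endomorphism `A_k^g` defined by
`g (u, v) = k (A_k^g u, v)`. -/
def metricRoot (g k : V →L[ℝ] V →L[ℝ] ℝ) : V →L[ℝ] V :=
  Classical.epsilon fun B => IsMetricRoot g k B

end LinearAlgebra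

/-! ### Fields on a seven-dimensional manifold -/

section Manifold

variable (M : Type*) [TopologicalSpace M] [ChartedSpace E7 M]

/-- Fields of alternating three-forms on `M` (smoothness is a separate condition). -/
abbrev FormField : Type _ := ∀ x : M, TangentSpace (𝓡 7) x [⋀^Fin 3]→L[ℝ] ℝ

/-- Smooth Riemannian metrics on `M`. -/
abbrev Metric [IsManifold (𝓡 7) ∞ M] : Type _ :=
  Bundle.ContMDiffRiemannianMetric (𝓡 7) ∞ E7 (fun x : M => TangentSpace (𝓡 7) x)

variable {M} [IsManifold (𝓡 7) ∞ M]

/-- The set `Ω³₊(M)` of positive three-forms: smooth sections of `Λ³T*M` that are positive at every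
point. -/
def PositiveForms (M : Type*) [TopologicalSpace M] [ChartedSpace E7 M] [IsManifold (𝓡 7) ∞ M] :
    Set (FormField M) :=
  {φ | ContMDiff (𝓡 7) ((𝓡 7).prod 𝓘(ℝ, E7 [⋀^Fin 3]→L[ℝ] ℝ)) ∞
      (fun x : M => Bundle.TotalSpace.mk' (E7 [⋀^Fin 3]→L[ℝ] ℝ)
        (E := fun x : M => TangentSpace (𝓡 7) x [⋀^Fin 3]→L[ℝ] Bundle.Trivial M ℝ x) x (φ x)) ∧
    ∀ x, IsPositive (φ x)}

/-- The Riemannian metric `g` is the metric induced by `φ`. -/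
def Induces (φ : FormField M) (g : Metric M) : Prop :=
  ∀ x, inducedMetric (φ x) = g.inner x

/-- A family of metrics is a smooth curve on the time interval `J`: it is smooth in
`(t, x) ∈ J × M`. -/
def IsSmoothMetricCurve (J : Set ℝ) (g : ℝ → Metric M) : Prop :=
  ContMDiffOn ((𝓘(ℝ, ℝ)).prod (𝓡 7)) ((𝓡 7).prod 𝓘(ℝ, E7 →L[ℝ] E7 →L[ℝ] ℝ)) ∞
    (fun p : ℝ × M => Bundle.TotalSpace.mk' (E7 →L[ℝ] E7 →L[ℝ] ℝ)
      (E := fun x : M =>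
        TangentSpace (𝓡 7) x →L[ℝ] TangentSpace (𝓡 7) x →L[ℝ] Bundle.Trivial M ℝ x)
      p.2 ((g p.1).inner p.2))
    (J ×ˢ univ)

/-- A family of three-forms is a smooth curve on the time interval `J`: it is smooth in
`(t, x) ∈ J × M`. -/
def IsSmoothFormCurve (J : Set ℝ) (φ : ℝ → FormField M) : Prop :=
  ContMDiffOn ((𝓘(ℝ, ℝ)).prod (𝓡 7)) ((𝓡 7).prod 𝓘(ℝ, E7 [⋀^Fin 3]→L[ℝ] ℝ)) ∞
    (fun p : ℝ × M => Bundle.TotalSpace.mk' (E7 [⋀^Fin 3]→L[ℝ] ℝ)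
      (E := fun x : M => TangentSpace (𝓡 7) x [⋀^Fin 3]→L[ℝ] Bundle.Trivial M ℝ x)
      p.2 (φ p.1 p.2))
    (J ×ˢ univ)

/-- The velocity `ġ_t` at the point `x` of a curve of metrics on the time interval `J` (one-sided at
the end points of `J`). -/
def velocity (J : Set ℝ) (g : ℝ → Metric M) (t : ℝ) (x : M) :
    TangentSpace (𝓡 7) x →L[ℝ] TangentSpace (𝓡 7) x →L[ℝ] ℝ :=
  derivWithin (fun s => (g s).inner x) J t

/-- `φ_t`, `t ∈ J`, is a smooth curve in `Ω³₊(M)` that solves the initial value problem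
`φ̇_t = (3/2) i_{φ_t}(ġ_t)`, `φ_0 = φ₀`. -/
structure IsSolution (J : Set ℝ) (g : ℝ → Metric M) (φ₀ : FormField M) (φ : ℝ → FormField M) :
    Prop where
  smooth : IsSmoothFormCurve J φ
  mem_positive : ∀ t ∈ J, φ t ∈ PositiveForms M
  initial : φ 0 = φ₀
  ode : ∀ t ∈ J, ∀ x, HasDerivWithinAt (fun s => φ s x)
    ((3 / 2 : ℝ) • iMap (φ t x) (velocity J g t x)) J t

/-- The endomorphisms `B_{g_t}^{g_0}`, `t ∈ J`, commute at every point. -/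
def IsPointwiseFlat (J : Set ℝ) (g : ℝ → Metric M) : Prop :=
  ∀ t₁ ∈ J, ∀ t₂ ∈ J, ∀ x : M,
    (metricRoot ((g 0).inner x) ((g t₁).inner x)).comp
        (metricRoot ((g 0).inner x) ((g t₂).inner x)) =
      (metricRoot ((g 0).inner x) ((g t₂).inner x)).comp
        (metricRoot ((g 0).inner x) ((g t₁).inner x))

end Manifold

end G2

end

/-!
# Evolution of positive three-forms along a curve of metrics

At a single point the equation `φ̇ = (3/2) i_φ(k̇)` is an equation for a curve of three-forms on
`ℝ⁷` that depends on a given curve `k` of inner products. The term `(3/2) i_φ(h)` is the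
infinitesimal action on `φ` of the endomorphism `½ h^♯` (`three_halves_smul_iMap`). The metric
induced by `φ` moves along with that action (`IsPositive.hasDerivWithinAt_inducedMetric`), so that
along a solution it has velocity `k̇`, and a solution that induces `k 0` at time `0` induces `k t`
at all times (`IsFormSolution.inducedMetric_eq`). Hence the index is raised with the known metric
`k t`, and the equation becomes the linear equation `φ̇ = (½ k⁻¹ k̇) · φ`. Let `N` be the solution
of `Ṅ = -½ k⁻¹ k̇ N`, `N 0 = 1`, here called the transport of `k`. The pull-back of a solution by
`N` is constant, so that `φ t = (N t)⁻¹^* φ 0` is the only solution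
(`IsFormSolution.eq_comp_inverse`), and this formula does define a solution
(`IsTransport.isFormSolution`). This gives the first part at each point.

For the derivative of the induced metric, the metric is written as a function of the form: for a
covector `β` with `β u = 1` the determinant of the matrix of `u ⌟ φ + β ⊗ β` is, up to sign,
`(det f)² |f u|⁴` when `φ = f^* φ₀` (`abs_det_contractMatrix_add`). This determines `|f u|²` up to the
factor `|det f|`, which is in turn determined by the Gram determinant. The same formula shows that
the metric does not depend on the adapted frame.

Smoothness in `(t, x)` is the smooth dependence of the transport on parameters, over a time
interval that need not be open. The substitution of `s t` for the time turns the linear equation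
on `[0, t]` into a Volterra equation on `[0, 1]` whose coefficient is a smooth function of `t` and
the parameters with values in `C([0, 1])`. Volterra operators `K` have an invertible `1 - K`, and
inversion is smooth (`exists_linear_ode`). The transports at the points of a chart are conjugate
to those of the metrics in coordinates (`exists_local_transport`), and by uniqueness the local
families agree with a transport chosen at each point (`isSmoothFormCurve_comp_inverse`).

For the second part, let `B t` be the square root `B_{g_t}^{g_0}` at a point, so that
`B² = k⁻¹ k₀`. If these endomorphisms commute, then `B` is differentiable, `Ḃ` commutes with `B`, and
differentiating `B²` gives `Ḃ = -½ k⁻¹ k̇ B`. So `B` is the transport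
(`IsInnerCurve.isTransport_metricRoot`) and `φ t = (B t)⁻¹^* φ 0` depends only on `g_0` and `g_t`.
-/

noncomputable section

namespace G2

/-! ### The standard form and its contractions -/

/-- The standard basis of `ℝ⁷`. -/
def stdBasis (i : Fin 7) : E7 := EuclideanSpace.single i 1

/-- The matrix of the two-form `u ⌟ φ` in the standard basis. -/
def contractMatrix (φ : E7 [⋀^Fin 3]→L[ℝ] ℝ) (u : E7) : Matrix (Fin 7) (Fin 7) ℝ :=
  Matrix.of fun i j => φ ![u, stdBasis i, stdBasis j]

theorem elemForm_apply (a b c : Fin 7) (u v w : E7) :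
    elemForm a b c ![u, v, w] = u a * v b * w c - u a * v c * w b - u b * v a * w c
      + u b * v c * w a + u c * v a * w b - u c * v b * w a :=
  Matrix.det_fin_three _

theorem stdForm_apply (u v w : E7) : stdForm ![u, v, w] =
    elemForm 0 1 2 ![u, v, w] + elemForm 0 3 4 ![u, v, w] + elemForm 0 5 6 ![u, v, w]
    + elemForm 1 3 5 ![u, v, w] - elemForm 1 4 6 ![u, v, w] - elemForm 2 3 6 ![u, v, w]
    - elemForm 2 4 5 ![u, v, w] := rfl

theorem contractMatrix_stdForm (u : E7) : contractMatrix stdForm u =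
    !![0, u 2, -u 1, u 4, -u 3, u 6, -u 5;
       -u 2, 0, u 0, u 5, -u 6, -u 3, u 4;
       u 1, -u 0, 0, -u 6, -u 5, u 4, u 3;
       -u 4, -u 5, u 6, 0, u 0, u 1, -u 2;
       u 3, u 6, u 5, -u 0, 0, -u 2, -u 1;
       -u 6, u 3, -u 4, -u 1, u 2, 0, u 0;
       u 5, -u 4, -u 3, u 2, u 1, -u 0, 0] := by
  ext i j
  simp only [contractMatrix, Matrix.of_apply, stdForm_apply, elemForm_apply, stdBasis,
    PiLp.single_apply]
  fin_cases i <;> fin_cases j <;> simp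

/-- With `P = u ⌟ φ₀`, the identity `P Pᵀ = |u|² - u uᵀ`, which says that `|u × v|` is the area
spanned by `u` and `v` for the cross product `×` of `φ₀`. -/
theorem contractMatrix_stdForm_mul_transpose (u : E7) :
    contractMatrix stdForm u * (contractMatrix stdForm u).transpose =
      (∑ i, u i ^ 2) • (1 : Matrix (Fin 7) (Fin 7) ℝ) - Matrix.vecMulVec u u := by
  rw [contractMatrix_stdForm]
  ext i j
  rw [Matrix.mul_apply]
  fin_cases i <;> fin_cases j <;>
    simp [Fin.sum_univ_seven, Matrix.vecMulVec] <;> ring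

section

open Matrix

theorem contractMatrix_stdForm_mulVec (u : E7) :
    contractMatrix stdForm u *ᵥ u.ofLp = 0 := by
  rw [contractMatrix_stdForm]
  ext i
  fin_cases i <;> simp [mulVec, dotProduct, Fin.sum_univ_seven] <;> ring

theorem contractMatrix_stdForm_transpose (u : E7) :
    (contractMatrix stdForm u)ᵀ = -contractMatrix stdForm u := by
  rw [contractMatrix_stdForm]
  ext i j
  fin_cases i <;> fin_cases j <;> simp

theorem stdForm_eq_dotProduct (u v w : E7) :
    stdForm ![u, v, w] = v.ofLp ⬝ᵥ (contractMatrix stdForm u *ᵥ w.ofLp) := by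
  rw [contractMatrix_stdForm, stdForm_apply]
  simp only [elemForm_apply, mulVec, dotProduct, Fin.sum_univ_seven, Matrix.of_apply,
    Matrix.cons_val', Matrix.cons_val]
  ring

theorem det_one_add_vecMulVec (v w : Fin 7 → ℝ) : det (1 + vecMulVec v w) = 1 + w ⬝ᵥ v := by
  rw [vecMulVec_eq Unit, det_one_add_replicateCol_mul_replicateRow]

/-- The shear `1 + v γᵀ` along the kernel `v` of a skew matrix `M` moves a covector with given value
on `v` to any other one, so the determinant of `M + β βᵀ` sees only `β v`. -/
theorem det_add_vecMulVec_eq_of_dotProduct_eq {M : Matrix (Fin 7) (Fin 7) ℝ} {v α β : Fin 7 → ℝ}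
    (hM : Mᵀ = -M) (hv : M *ᵥ v = 0) (hα : α ⬝ᵥ v = 1) (hβ : β ⬝ᵥ v = 1) :
    det (M + vecMulVec β β) = det (M + vecMulVec α α) := by
  have hv' : v ᵥ* M = 0 := by
    rw [← mulVec_transpose, hM, neg_mulVec, hv, neg_zero]
  have key : (1 + vecMulVec v (β - α))ᵀ * (M + vecMulVec α α) * (1 + vecMulVec v (β - α))
      = M + vecMulVec β β := by
    have h1 : (M + vecMulVec α α) * (1 + vecMulVec v (β - α)) = M + vecMulVec α β := by
      rw [mul_add, mul_one, add_mul, mul_vecMulVec, hv, vecMulVec_mul_vecMulVec, hα]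
      simp only [one_smul, zero_vecMulVec, zero_add]
      rw [vecMulVec_sub]
      abel
    rw [mul_assoc, h1, transpose_add, transpose_one, transpose_vecMulVec, add_mul, one_mul, mul_add,
      vecMulVec_mul, hv', vecMulVec_mul_vecMulVec, dotProduct_comm v α, hα]
    simp only [one_smul, vecMulVec_zero, zero_add]
    rw [sub_vecMulVec]
    abel
  have hdet : det (1 + vecMulVec v (β - α)) = 1 := by
    rw [det_one_add_vecMulVec, sub_dotProduct, hα, hβ]; ring
  rw [← key, det_mul, det_mul, det_transpose, hdet]; ring

/-- The determinant of `v ⌟ φ₀ + β ⊗ β` sees the Euclidean length of `v`, whatever covector `β` with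
`β v = 1` is used to fill the kernel of `v ⌟ φ₀`. It suffices to take `β` proportional to `v`. -/
theorem abs_det_contractMatrix_stdForm_add (v : E7) (β : Fin 7 → ℝ) (hβ : β ⬝ᵥ v.ofLp = 1) :
    |det (contractMatrix stdForm v + vecMulVec β β)| = (∑ i, v i ^ 2) ^ 2 := by
  set M := contractMatrix stdForm v with hMdef
  set n : ℝ := ∑ i, v i ^ 2 with hn
  have hnv : v.ofLp ⬝ᵥ v.ofLp = n := by simp [dotProduct, hn, sq]
  have hn0 : n ≠ 0 := by
    intro h0
    rw [← hnv, dotProduct_self_eq_zero] at h0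
    rw [h0] at hβ
    simp at hβ
  have hM : Mᵀ = -M := contractMatrix_stdForm_transpose v
  have hMv : M *ᵥ v.ofLp = 0 := contractMatrix_stdForm_mulVec v
  have hMM : M * Mᵀ = n • (1 : Matrix (Fin 7) (Fin 7) ℝ) - vecMulVec v.ofLp v.ofLp :=
    contractMatrix_stdForm_mul_transpose v
  have hvM : v.ofLp ᵥ* Mᵀ = 0 := by rw [vecMul_transpose, hMv]
  have hα : (n⁻¹ • v.ofLp) ⬝ᵥ v.ofLp = 1 := by rw [smul_dotProduct, hnv]; simp [hn0]
  rw [det_add_vecMulVec_eq_of_dotProduct_eq hM hMv hα hβ]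
  -- The square of the determinant is that of `n + c v vᵀ`.
  have hsq : (M + vecMulVec (n⁻¹ • v.ofLp) (n⁻¹ • v.ofLp)) *
      (M + vecMulVec (n⁻¹ • v.ofLp) (n⁻¹ • v.ofLp))ᵀ =
      n • (1 + vecMulVec ((n⁻¹ * (n⁻¹ ^ 3 - 1)) • v.ofLp) v.ofLp) := by
    rw [transpose_add, transpose_vecMulVec, mul_add, add_mul, add_mul, hMM, mul_vecMulVec,
      vecMulVec_mul, vecMulVec_mul_vecMulVec, mulVec_smul, hMv, smul_vecMul, hvM]
    simp only [smul_zero, zero_vecMulVec, vecMulVec_zero, add_zero, zero_add, smul_vecMulVec,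
      vecMulVec_smul, smul_dotProduct, dotProduct_smul, hnv, smul_add, smul_smul, smul_eq_mul]
    have e2 : n * (n⁻¹ * (n⁻¹ ^ 3 - 1)) = n⁻¹ ^ 3 - 1 := by field_simp
    rw [e2, sub_smul, one_smul]
    have e3 : n⁻¹ * (n⁻¹ * n) * n⁻¹ * n⁻¹ = n⁻¹ ^ 3 := by field_simp
    rw [e3]
    abel
  have hdet := congrArg det hsq
  rw [det_mul, det_transpose, det_smul, det_one_add_vecMulVec, dotProduct_smul, hnv] at hdet
  have h4 : det (M + vecMulVec (n⁻¹ • v.ofLp) (n⁻¹ • v.ofLp)) ^ 2 = (n ^ 2) ^ 2 := by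
    rw [sq, hdet]
    simp only [Fintype.card_fin, smul_eq_mul]
    field_simp
    ring
  have := (sq_eq_sq_iff_abs_eq_abs _ _).1 h4
  rw [this, abs_of_nonneg (by positivity)]

/-- The matrix of a linear isomorphism of `ℝ⁷` in the standard basis. -/
def frameMatrix (f : E7 ≃L[ℝ] E7) : Matrix (Fin 7) (Fin 7) ℝ :=
  of fun i j => f (stdBasis j) i

theorem eq_sum_stdBasis (u : E7) : u = ∑ i, u i • stdBasis i := by
  ext j
  simp [stdBasis, Pi.single_apply, WithLp.ofLp_sum, Finset.sum_apply]

theorem ofLp_frame (f : E7 ≃L[ℝ] E7) (u : E7) : (f u).ofLp = frameMatrix f *ᵥ u.ofLp := by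
  ext i
  conv_lhs => rw [eq_sum_stdBasis u]
  simp [frameMatrix, mulVec, dotProduct, WithLp.ofLp_sum, Finset.sum_apply, mul_comm]

theorem isUnit_det_frameMatrix (f : E7 ≃L[ℝ] E7) : IsUnit (frameMatrix f).det := by
  have h : frameMatrix f.symm * frameMatrix f = 1 := by
    apply Matrix.ext_of_mulVec_single
    intro i
    have := ofLp_frame f (stdBasis i)
    have h2 := ofLp_frame f.symm (f (stdBasis i))
    rw [this, mulVec_mulVec, f.symm_apply_apply] at h2
    rw [one_mulVec]
    exact h2.symm
  exact isUnit_det_of_left_inverse h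

theorem contractMatrix_comp (f : E7 ≃L[ℝ] E7) (u : E7) :
    contractMatrix (stdForm.compContinuousLinearMap (f : E7 →L[ℝ] E7)) u =
      (frameMatrix f)ᵀ * contractMatrix stdForm (f u) * frameMatrix f := by
  ext i j
  have h1 : contractMatrix (stdForm.compContinuousLinearMap (f : E7 →L[ℝ] E7)) u i j =
      stdForm ![f u, f (stdBasis i), f (stdBasis j)] := by
    simp only [contractMatrix, of_apply, ContinuousAlternatingMap.compContinuousLinearMap_apply]
    congr 1
    ext k : 1
    fin_cases k <;> rfl
  rw [h1, stdForm_eq_dotProduct, mul_assoc, mul_apply]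
  simp only [dotProduct, transpose_apply, frameMatrix, of_apply, mul_apply, mulVec]

/-- Up to sign, the determinant of `u ⌟ φ + β ⊗ β` is `(det f)² |f u|⁴` when `φ = f^* φ₀` and
`β u = 1`. -/
theorem abs_det_contractMatrix_add (f : E7 ≃L[ℝ] E7) (u : E7) (α : Fin 7 → ℝ)
    (hα : α ⬝ᵥ u.ofLp = 1) :
    |det (contractMatrix (stdForm.compContinuousLinearMap (f : E7 →L[ℝ] E7)) u
      + vecMulVec α α)| = (|det (frameMatrix f)| * inner ℝ (f u) (f u)) ^ 2 := by
  set F := frameMatrix f with hF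
  have hFu : IsUnit F.det := isUnit_det_frameMatrix f
  set β := α ᵥ* F⁻¹ with hβ
  have hβF : β ᵥ* F = α := by rw [hβ, vecMul_vecMul, nonsing_inv_mul _ hFu, vecMul_one]
  have hβv : β ⬝ᵥ (f u).ofLp = 1 := by
    rw [ofLp_frame, dotProduct_mulVec, ← hF, hβF, hα]
  have hfac : contractMatrix (stdForm.compContinuousLinearMap (f : E7 →L[ℝ] E7)) u
      + vecMulVec α α = Fᵀ * (contractMatrix stdForm (f u) + vecMulVec β β) * F := by
    rw [contractMatrix_comp, mul_add, add_mul, mul_vecMulVec, vecMulVec_mul, hβF, mulVec_transpose,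
      hβF]
  rw [hfac, det_mul, det_mul, det_transpose, abs_mul, abs_mul,
    abs_det_contractMatrix_stdForm_add _ _ hβv]
  have : inner ℝ (f u) (f u) = ∑ i, f u i ^ 2 := by
    rw [real_inner_self_eq_norm_sq, EuclideanSpace.real_norm_sq_eq]
  rw [this]
  ring

/-! ### The induced metric as a function of the form -/

/-- The quadratic form `|det f| ⟨f u, f u⟩` of a positive form `φ = f^* φ₀`, written in terms of
`φ` alone. At `u = 0` the contraction and the junk value `0⁻¹ • 0` both vanish, so that the value is
`0` there as well. -/
def densQuad (φ : E7 [⋀^Fin 3]→L[ℝ] ℝ) (u : E7) : ℝ :=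
  √|det (contractMatrix φ u
    + vecMulVec ((u.ofLp ⬝ᵥ u.ofLp)⁻¹ • u.ofLp) ((u.ofLp ⬝ᵥ u.ofLp)⁻¹ • u.ofLp))|

/-- The polarisation of `densQuad`. -/
def densPolar (φ : E7 [⋀^Fin 3]→L[ℝ] ℝ) (u v : E7) : ℝ :=
  (densQuad φ (u + v) - densQuad φ (u - v)) / 4

/-- The metric of a positive form, written in terms of the form alone: `densPolar`, rescaled by its
Gram determinant. -/
def metricFormula (φ : E7 [⋀^Fin 3]→L[ℝ] ℝ) (u v : E7) : ℝ :=
  densPolar φ u v * (det (of fun i j => densPolar φ (stdBasis i) (stdBasis j))) ^ (-(1 / 9) : ℝ)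

theorem dotProduct_inv_smul_self {u : E7} (hu : u ≠ 0) :
    ((u.ofLp ⬝ᵥ u.ofLp)⁻¹ • u.ofLp) ⬝ᵥ u.ofLp = 1 := by
  rw [smul_dotProduct, smul_eq_mul, inv_mul_cancel₀]
  rw [Ne, dotProduct_self_eq_zero]
  contrapose! hu
  ext i
  exact congrFun hu i

theorem contractMatrix_zero (φ : E7 [⋀^Fin 3]→L[ℝ] ℝ) : contractMatrix φ 0 = 0 := by
  ext i j
  exact φ.map_coord_zero 0 rfl

section Frame

variable (f : E7 ≃L[ℝ] E7)

theorem densQuad_comp (u : E7) :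
    densQuad (stdForm.compContinuousLinearMap (f : E7 →L[ℝ] E7)) u =
      |det (frameMatrix f)| * inner ℝ (f u) (f u) := by
  by_cases hu : u = 0
  · subst hu
    simp [densQuad, contractMatrix_zero]
  · rw [densQuad, abs_det_contractMatrix_add f u _ (dotProduct_inv_smul_self hu),
      Real.sqrt_sq (mul_nonneg (abs_nonneg _) real_inner_self_nonneg)]

theorem densPolar_comp (u v : E7) :
    densPolar (stdForm.compContinuousLinearMap (f : E7 →L[ℝ] E7)) u v =
      |det (frameMatrix f)| * inner ℝ (f u) (f v) := by
  rw [densPolar, densQuad_comp, densQuad_comp, map_add, map_sub, real_inner_add_add_self,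
    real_inner_sub_sub_self]
  ring

/-- The exponent `9` is `7` from the scaling by `|det f|` and `2` from the Gram determinant. -/
theorem det_densPolar_comp :
    det (of fun i j => densPolar (stdForm.compContinuousLinearMap (f : E7 →L[ℝ] E7))
      (stdBasis i) (stdBasis j)) = |det (frameMatrix f)| ^ 9 := by
  have h : (of fun i j => densPolar (stdForm.compContinuousLinearMap (f : E7 →L[ℝ] E7))
      (stdBasis i) (stdBasis j)) =
      |det (frameMatrix f)| • ((frameMatrix f)ᵀ * frameMatrix f) := by
    ext i j
    simp [densPolar_comp, mul_apply, frameMatrix, PiLp.inner_apply, mul_comm]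
  rw [h, det_smul, det_mul, det_transpose, Fintype.card_fin, ← abs_mul_abs_self]
  ring

theorem metricFormula_comp (u v : E7) :
    metricFormula (stdForm.compContinuousLinearMap (f : E7 →L[ℝ] E7)) u v
      = inner ℝ (f u) (f v) := by
  have h0 : 0 < |det (frameMatrix f)| := abs_pos.2 (isUnit_det_frameMatrix f).ne_zero
  rw [metricFormula, densPolar_comp, det_densPolar_comp, ← Real.rpow_natCast, ← Real.rpow_mul h0.le]
  norm_num
  rw [Real.rpow_neg_one]
  field_simp

end Frame

/-- A compatible inner product is a function of the three-form alone. This replaces the fact that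
the stabiliser of `φ₀` preserves the Euclidean inner product. -/
theorem IsCompatible.eq_metricFormula {φ : E7 [⋀^Fin 3]→L[ℝ] ℝ} {k : E7 →L[ℝ] E7 →L[ℝ] ℝ}
    (h : IsCompatible φ k) (u v : E7) : k u v = metricFormula φ u v := by
  obtain ⟨f, hf, hk⟩ := h
  rw [hk, hf, metricFormula_comp]

/-- The metric pulled back by an adapted frame does not depend on the frame. -/
theorem IsCompatible.inducedMetric_eq {φ : E7 [⋀^Fin 3]→L[ℝ] ℝ} {k : E7 →L[ℝ] E7 →L[ℝ] ℝ}
    (h : IsCompatible φ k) : inducedMetric φ = k := by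
  have h' : IsCompatible φ (inducedMetric φ) := Classical.epsilon_spec ⟨k, h⟩
  ext u v
  rw [h'.eq_metricFormula, h.eq_metricFormula]

theorem IsPositive.isCompatible {φ : E7 [⋀^Fin 3]→L[ℝ] ℝ} (h : IsPositive φ) :
    IsCompatible φ (inducedMetric φ) := by
  obtain ⟨f, hf⟩ := h
  exact Classical.epsilon_spec
    (p := fun k => IsCompatible φ k)
    ⟨(innerSL ℝ (E := E7)).bilinearComp (f : E7 →L[ℝ] E7) (f : E7 →L[ℝ] E7), f, hf, fun _ _ => rfl⟩

theorem IsPositive.inducedMetric_apply {φ : E7 [⋀^Fin 3]→L[ℝ] ℝ} (h : IsPositive φ) (u v : E7) :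
    inducedMetric φ u v = metricFormula φ u v :=
  h.isCompatible.eq_metricFormula u v

theorem IsPositive.comp {φ : E7 [⋀^Fin 3]→L[ℝ] ℝ} (h : IsPositive φ) (A : E7 ≃L[ℝ] E7) :
    IsPositive (φ.compContinuousLinearMap (A : E7 →L[ℝ] E7)) := by
  obtain ⟨f, hf⟩ := h
  exact ⟨A.trans f, by rw [hf]; rfl⟩

theorem IsPositive.inducedMetric_comp {φ : E7 [⋀^Fin 3]→L[ℝ] ℝ} (h : IsPositive φ)
    (A : E7 ≃L[ℝ] E7) (u v : E7) :
    inducedMetric (φ.compContinuousLinearMap (A : E7 →L[ℝ] E7)) u v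
      = inducedMetric φ (A u) (A v) := by
  obtain ⟨f, hf, hk⟩ := h.isCompatible
  have : IsCompatible (φ.compContinuousLinearMap (A : E7 →L[ℝ] E7))
      ((inducedMetric φ).bilinearComp (A : E7 →L[ℝ] E7) (A : E7 →L[ℝ] E7)) :=
    ⟨A.trans f, by rw [IsAdaptedFrame, hf]; rfl, fun u v => hk _ _⟩
  rw [this.inducedMetric_eq]
  rfl

/-! ### Differentiability of the induced metric -/

theorem differentiableAt_det {E : Type*} [NormedAddCommGroup E] [NormedSpace ℝ E]
    {M : E → Matrix (Fin 7) (Fin 7) ℝ} {x : E}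
    (h : ∀ i j, DifferentiableAt ℝ (fun y => M y i j) x) :
    DifferentiableAt ℝ (fun y => det (M y)) x := by
  simp only [det_apply']
  fun_prop

theorem IsPositive.differentiableAt_densQuad {φ : E7 [⋀^Fin 3]→L[ℝ] ℝ} (h : IsPositive φ) (u : E7) :
    DifferentiableAt ℝ (fun ψ => densQuad ψ u) φ := by
  by_cases hu : u = 0
  · subst hu
    simp [densQuad, contractMatrix_zero]
  · obtain ⟨f, hf⟩ := h
    have hpos := abs_det_contractMatrix_add f u _ (dotProduct_inv_smul_self hu)
    have hne : det (contractMatrix φ u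
        + vecMulVec ((u.ofLp ⬝ᵥ u.ofLp)⁻¹ • u.ofLp) ((u.ofLp ⬝ᵥ u.ofLp)⁻¹ • u.ofLp)) ≠ 0 := by
      rw [hf, ← abs_ne_zero, hpos]
      have h1 := (isUnit_det_frameMatrix f).ne_zero
      have h2 : f u ≠ 0 := by simpa using hu
      have h3 : inner ℝ (f u) (f u) ≠ 0 := by simpa using h2
      positivity
    have hd : DifferentiableAt ℝ (fun ψ => det (contractMatrix ψ u
        + vecMulVec ((u.ofLp ⬝ᵥ u.ofLp)⁻¹ • u.ofLp) ((u.ofLp ⬝ᵥ u.ofLp)⁻¹ • u.ofLp))) φ := by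
      refine differentiableAt_det fun i j => ?_
      simp only [Matrix.add_apply, contractMatrix, of_apply]
      exact (differentiableAt_id.continuousAlternatingMap_apply_const _).add_const _
    exact (hd.abs hne).sqrt (abs_ne_zero.2 hne)

theorem IsPositive.differentiableAt_metricFormula {φ : E7 [⋀^Fin 3]→L[ℝ] ℝ} (h : IsPositive φ)
    (u v : E7) : DifferentiableAt ℝ (fun ψ => metricFormula ψ u v) φ := by
  have hp : ∀ u v, DifferentiableAt ℝ (fun ψ => densPolar ψ u v) φ := fun u v => by
    simp only [densPolar, div_eq_mul_inv]
    exact ((h.differentiableAt_densQuad _).sub (h.differentiableAt_densQuad _)).mul_const _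
  refine (hp u v).mul (DifferentiableAt.rpow_const (differentiableAt_det fun i j => hp _ _) ?_)
  left
  obtain ⟨f, hf⟩ := h
  rw [hf, det_densPolar_comp]
  exact pow_ne_zero _ (abs_ne_zero.2 (isUnit_det_frameMatrix f).ne_zero)

end

section

open Filter Topology

theorem eq_of_hasDerivWithinAt_zero {F : Type*} [NormedAddCommGroup F] [NormedSpace ℝ F]
    {J : Set ℝ} (hJ : J.OrdConnected) {f : ℝ → F} (h : ∀ t ∈ J, HasDerivWithinAt f 0 J t)
    {s t : ℝ} (hs : s ∈ J) (ht : t ∈ J) : f t = f s := by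
  have := hJ.convex.norm_image_sub_le_of_norm_hasDerivWithin_le (C := 0) h (by simp) hs ht
  rw [zero_mul] at this
  exact sub_eq_zero.1 (norm_le_zero_iff.1 this)

/-! ### The infinitesimal action of endomorphisms on three-forms -/

/-- The action `φ(S ·, ·, ·) + φ(·, S ·, ·) + φ(·, ·, S ·)` of an endomorphism on a three-form. -/
def lieAct (φ : E7 [⋀^Fin 3]→L[ℝ] ℝ) : (E7 →L[ℝ] E7) →L[ℝ] (E7 [⋀^Fin 3]→L[ℝ] ℝ) :=
  φ.fderivCompContinuousLinearMap (ContinuousLinearMap.id ℝ E7)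

theorem lieAct_apply (φ : E7 [⋀^Fin 3]→L[ℝ] ℝ) (S : E7 →L[ℝ] E7) (v : Fin 3 → E7) :
    lieAct φ S v = φ ![S (v 0), v 1, v 2] + φ ![v 0, S (v 1), v 2] + φ ![v 0, v 1, S (v 2)] := by
  rw [lieAct, ContinuousAlternatingMap.fderivCompContinuousLinearMap_apply, Fin.sum_univ_three]
  congr 1
  · congr 1 <;> (congr 1; ext j : 1; fin_cases j <;> simp [Function.update])
  · congr 1; ext j : 1; fin_cases j <;> simp [Function.update]

theorem fderivCompContinuousLinearMap_comp (φ : E7 [⋀^Fin 3]→L[ℝ] ℝ) (N C : E7 →L[ℝ] E7) :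
    φ.fderivCompContinuousLinearMap N (C ∘L N) = (lieAct φ C).compContinuousLinearMap N := by
  ext v
  rw [ContinuousAlternatingMap.compContinuousLinearMap_apply, lieAct,
    ContinuousAlternatingMap.fderivCompContinuousLinearMap_apply,
    ContinuousAlternatingMap.fderivCompContinuousLinearMap_apply]
  refine Finset.sum_congr rfl fun i _ => congrArg φ (funext fun j => ?_)
  by_cases h : j = i
  · subst h; simp
  · simp [h]

theorem fderivCompContinuousLinearMap_comp' (φ : E7 [⋀^Fin 3]→L[ℝ] ℝ) (N C : E7 →L[ℝ] E7) :
    φ.fderivCompContinuousLinearMap N (N ∘L C) = lieAct (φ.compContinuousLinearMap N) C := by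
  ext v
  rw [lieAct, ContinuousAlternatingMap.fderivCompContinuousLinearMap_apply,
    ContinuousAlternatingMap.fderivCompContinuousLinearMap_apply]
  simp only [ContinuousAlternatingMap.compContinuousLinearMap_apply]
  refine Finset.sum_congr rfl fun i _ => congrArg φ (funext fun j => ?_)
  by_cases h : j = i
  · subst h; simp
  · simp [h]

theorem hasDerivWithinAt_compContinuousLinearMap {J : Set ℝ} {t : ℝ}
    {η : ℝ → E7 [⋀^Fin 3]→L[ℝ] ℝ} {η' : E7 [⋀^Fin 3]→L[ℝ] ℝ} {N : ℝ → E7 →L[ℝ] E7}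
    {N' : E7 →L[ℝ] E7} (hη : HasDerivWithinAt η η' J t) (hN : HasDerivWithinAt N N' J t) :
    HasDerivWithinAt (fun s => (η s).compContinuousLinearMap (N s))
      (η'.compContinuousLinearMap (N t) + (η t).fderivCompContinuousLinearMap (N t) N') J t := by
  have h := hη.hasFDerivWithinAt.continuousAlternatingMapCompContinuousLinearMap
    hN.hasFDerivWithinAt
  have h' := h.hasDerivWithinAt
  simpa using h'

/-- A form moving with the infinitesimal action of `A`, pulled back by endomorphisms moving with
`-A`, is constant. -/
theorem hasDerivWithinAt_compContinuousLinearMap_zero {J : Set ℝ} {t : ℝ}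
    {η : ℝ → E7 [⋀^Fin 3]→L[ℝ] ℝ} {N : ℝ → E7 →L[ℝ] E7} {A : E7 →L[ℝ] E7}
    (hη : HasDerivWithinAt η (lieAct (η t) A) J t)
    (hN : HasDerivWithinAt N (-(A ∘L N t)) J t) :
    HasDerivWithinAt (fun s => (η s).compContinuousLinearMap (N s)) 0 J t := by
  have h := hasDerivWithinAt_compContinuousLinearMap hη hN
  rwa [map_neg, fderivCompContinuousLinearMap_comp, add_neg_cancel] at h

/-- The right-hand side `(3/2) i_φ(h)` of the equation is the infinitesimal action of `½ h^♯`: the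
skew-symmetrisation of `φ (h^♯ ·, ·, ·)` is a third of the action of `h^♯`. -/
theorem three_halves_smul_iMap (φ : E7 [⋀^Fin 3]→L[ℝ] ℝ) (h : E7 →L[ℝ] E7 →L[ℝ] ℝ) :
    (3 / 2 : ℝ) • iMap φ h = lieAct φ ((1 / 2 : ℝ) • raise (inducedMetric φ) h) := by
  set S := raise (inducedMetric φ) h with hS
  ext v
  rw [map_smul, ContinuousAlternatingMap.smul_apply, ContinuousAlternatingMap.smul_apply, iMap,
    ContinuousAlternatingMap.smul_apply, ContinuousMultilinearMap.alternatization_apply_apply,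
    lieAct_apply, ← hS]
  have hval : ∀ w : Fin 3 → E7, (φ.toContinuousMultilinearMap.compContinuousLinearMap
      fun i : Fin 3 => if i = 0 then S else ContinuousLinearMap.id ℝ E7) w
        = φ ![S (w 0), w 1, w 2] := by
    intro w
    change φ _ = φ _
    congr 1
    ext j : 1
    fin_cases j <;> rfl
  have hswap : ∀ a b c : E7, φ ![a, c, b] = -φ ![a, b, c] := by
    intro a b c
    have := φ.map_swap ![a, b, c] (i := 1) (j := 2) (by decide)
    refine Eq.trans ?_ this
    change φ _ = φ _
    congr 1
    ext j : 1
    fin_cases j <;> rfl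
  have hswap' : ∀ a b c : E7, φ ![b, a, c] = -φ ![a, b, c] := by
    intro a b c
    have := φ.map_swap ![a, b, c] (i := 0) (j := 1) (by decide)
    refine Eq.trans ?_ this
    change φ _ = φ _
    congr 1
    ext j : 1
    fin_cases j <;> rfl
  simp only [hval]
  have huniv : (Finset.univ : Finset (Equiv.Perm (Fin 3))) = {1, Equiv.swap 0 1, Equiv.swap 0 2,
      Equiv.swap 1 2, Equiv.swap 0 1 * Equiv.swap 1 2, Equiv.swap 0 2 * Equiv.swap 1 2} := by
    decide
  rw [huniv, Finset.sum_insert (by decide), Finset.sum_insert (by decide),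
    Finset.sum_insert (by decide), Finset.sum_insert (by decide), Finset.sum_insert (by decide),
    Finset.sum_singleton]
  have s01 : Equiv.Perm.sign (Equiv.swap (0 : Fin 3) 1) = -1 := by decide
  have s02 : Equiv.Perm.sign (Equiv.swap (0 : Fin 3) 2) = -1 := by decide
  have s12 : Equiv.Perm.sign (Equiv.swap (1 : Fin 3) 2) = -1 := by decide
  have hp1 : (![1, 0, 2] : Fin 3 → Fin 3) = Equiv.swap 0 1 := by decide
  have hp2 : (![2, 1, 0] : Fin 3 → Fin 3) = Equiv.swap 0 2 := by decide
  have hp3 : (![0, 2, 1] : Fin 3 → Fin 3) = Equiv.swap 1 2 := by decide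
  simp only [Function.comp_apply, Equiv.Perm.sign_one, Equiv.Perm.sign_mul, s01, s02, s12,
    Equiv.Perm.coe_mul, ← hp1, ← hp2, ← hp3, Equiv.Perm.coe_one, id_eq, Matrix.cons_val_zero,
    Matrix.cons_val_one, Matrix.cons_val, one_smul, mul_neg, mul_one, neg_neg, Units.neg_smul,
    smul_eq_mul]
  rw [hswap (S (v 1)) (v 0) (v 2), hswap' (v 0) (S (v 1)) (v 2), hswap (S (v 0)) (v 1) (v 2),
    hswap (S (v 2)) (v 0) (v 1), hswap' (v 0) (S (v 2)) (v 1), hswap (v 0) (v 1) (S (v 2))]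
  ring

/-- The derivative of the induced metric along the infinitesimal action of `A`. -/
theorem IsPositive.hasDerivWithinAt_inducedMetric {J : Set ℝ} {t : ℝ} (ht : t ∈ J)
    {η : ℝ → E7 [⋀^Fin 3]→L[ℝ] ℝ} {A : E7 →L[ℝ] E7} (hpos : ∀ s ∈ J, IsPositive (η s))
    (hη : HasDerivWithinAt η (lieAct (η t) A) J t) (u v : E7) :
    HasDerivWithinAt (fun s => inducedMetric (η s) u v)
      (inducedMetric (η t) (A u) v + inducedMetric (η t) u (A v)) J t := by
  have hp := hpos t ht
  set φ := η t with hφ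
  obtain hd := (hp.differentiableAt_metricFormula u v).hasFDerivAt
  set L := fderiv ℝ (fun ψ => metricFormula ψ u v) φ with hL
  -- The derivative in the direction of the action is computed along `s ↦ (1 + s A)^* φ`.
  have hLval : L (lieAct φ A) = inducedMetric φ (A u) v + inducedMetric φ u (A v) := by
    have hN : HasDerivAt (fun s : ℝ => ContinuousLinearMap.id ℝ E7 + s • A) A 0 := by
      simpa using ((hasDerivAt_id (0 : ℝ)).smul_const A).const_add (ContinuousLinearMap.id ℝ E7)
    have hid : ContinuousLinearMap.id ℝ E7 + (0 : ℝ) • A = ContinuousLinearMap.id ℝ E7 := by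
      ext u
      simp
    have hpath : HasDerivAt (fun s : ℝ => φ.compContinuousLinearMap
        (ContinuousLinearMap.id ℝ E7 + s • A)) (lieAct φ A) 0 := by
      have h := hasDerivWithinAt_compContinuousLinearMap
        (hasDerivWithinAt_const (0 : ℝ) univ φ) hN.hasDerivWithinAt
      rw [hasDerivWithinAt_univ] at h
      refine h.congr_deriv ?_
      rw [hid]
      ext v
      simp [lieAct]
    have h1 : HasDerivAt (fun s : ℝ => metricFormula (φ.compContinuousLinearMap
        (ContinuousLinearMap.id ℝ E7 + s • A)) u v) (L (lieAct φ A)) 0 := by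
      refine HasFDerivAt.comp_hasDerivAt (l := fun ψ => metricFormula ψ u v) (0 : ℝ) ?_ hpath
      have h0 : φ.compContinuousLinearMap (ContinuousLinearMap.id ℝ E7 + (0 : ℝ) • A) = φ := by
        rw [hid]
        rfl
      rw [h0]
      exact hd
    have h2 : HasDerivAt (fun s : ℝ => inducedMetric φ
        ((ContinuousLinearMap.id ℝ E7 + s • A) u) ((ContinuousLinearMap.id ℝ E7 + s • A) v))
        (inducedMetric φ (A u) v + inducedMetric φ u (A v)) 0 := by
      have hu : HasDerivAt (fun s : ℝ => (ContinuousLinearMap.id ℝ E7 + s • A) u) (A u) 0 := by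
        simpa using hN.clm_apply (hasDerivAt_const (0 : ℝ) u)
      have hv : HasDerivAt (fun s : ℝ => (ContinuousLinearMap.id ℝ E7 + s • A) v) (A v) 0 := by
        simpa using hN.clm_apply (hasDerivAt_const (0 : ℝ) v)
      simpa using ((inducedMetric φ).hasFDerivAt.comp_hasDerivAt (0 : ℝ) hu).clm_apply hv
    refine h1.unique (h2.congr_of_eventuallyEq ?_)
    have hunit : ∀ᶠ s : ℝ in 𝓝 0, IsUnit (ContinuousLinearMap.id ℝ E7 + s • A) := by
      have hc : ContinuousAt (fun s : ℝ => ContinuousLinearMap.id ℝ E7 + s • A) 0 :=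
        hN.continuousAt
      refine hc.eventually (Units.isOpen.eventually_mem ?_)
      change IsUnit (ContinuousLinearMap.id ℝ E7 + (0 : ℝ) • A)
      rw [hid]
      exact (isUnit_one : IsUnit (1 : E7 →L[ℝ] E7))
    filter_upwards [hunit] with s ⟨w, hw⟩
    rw [← hw]
    have := hp.inducedMetric_comp (ContinuousLinearEquiv.unitsEquiv ℝ E7 w) u v
    rw [IsPositive.inducedMetric_apply (hp.comp _)] at this
    exact this
  rw [← hLval]
  refine (hd.comp_hasDerivWithinAt t hη).congr (fun s hs => ?_) ?_
  · exact (hpos s hs).inducedMetric_apply u v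
  · exact hp.inducedMetric_apply u v

/-! ### Inner products and their transport -/

/-- `k` is an inner product on `ℝ⁷`. -/
structure IsInner (k : E7 →L[ℝ] E7 →L[ℝ] ℝ) : Prop where
  symm : ∀ u v, k u v = k v u
  pos : ∀ u, u ≠ 0 → 0 < k u u

namespace IsInner

variable {k : E7 →L[ℝ] E7 →L[ℝ] ℝ}

theorem eq_of_forall (hk : IsInner k) {a b : E7} (h : ∀ v, k a v = k b v) : a = b := by
  by_contra hab
  have := hk.pos (a - b) (sub_ne_zero.2 hab)
  rw [show k (a - b) = k a - k b from map_sub k a b, sub_apply, h, sub_self] at this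
  exact lt_irrefl _ this

theorem isInvertible (hk : IsInner k) : k.IsInvertible := by
  have hinj : Function.Injective (k : E7 →ₗ[ℝ] E7 →L[ℝ] ℝ) := fun a b hab =>
    hk.eq_of_forall fun v => congrArg (fun l : E7 →L[ℝ] ℝ => l v) hab
  have hfr : Module.finrank ℝ E7 = Module.finrank ℝ (E7 →L[ℝ] ℝ) := by
    rw [← (LinearMap.toContinuousLinearMap (𝕜 := ℝ) (E := E7) (F' := ℝ)).finrank_eq]
    exact Subspace.dual_finrank_eq.symm
  have : FiniteDimensional ℝ (E7 →L[ℝ] ℝ) :=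
    (LinearMap.toContinuousLinearMap (𝕜 := ℝ) (E := E7) (F' := ℝ)).finiteDimensional
  exact ⟨(LinearEquiv.ofInjectiveOfFinrankEq (k : E7 →ₗ[ℝ] E7 →L[ℝ] ℝ) hinj
    hfr).toContinuousLinearEquiv, by ext; rfl⟩

theorem inverse_apply (hk : IsInner k) (l : E7 →L[ℝ] ℝ) (v : E7) : k (k.inverse l) v = l v := by
  rw [hk.isInvertible.self_apply_inverse]

theorem raise_eq (hk : IsInner k) {h : E7 →L[ℝ] E7 →L[ℝ] ℝ} {S : E7 →L[ℝ] E7}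
    (hS : ∀ u v, k (S u) v = h u v) : raise k h = S := by
  have : ∀ u v, k (raise k h u) v = h u v :=
    Classical.epsilon_spec (p := fun S : E7 →L[ℝ] E7 => ∀ u v, k (S u) v = h u v) ⟨S, hS⟩
  ext1 u
  exact hk.eq_of_forall fun v => by rw [this, hS]

end IsInner

theorem isInner_of_frame {k : E7 →L[ℝ] E7 →L[ℝ] ℝ} {f : E7 ≃L[ℝ] E7}
    (h : ∀ u v, k u v = inner ℝ (f u) (f v)) : IsInner k where
  symm u v := by rw [h, h, real_inner_comm]
  pos u hu := by
    rw [h]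
    exact real_inner_self_pos.2 (by simpa using hu)

theorem IsPositive.isInner {φ : E7 [⋀^Fin 3]→L[ℝ] ℝ} (h : IsPositive φ) :
    IsInner (inducedMetric φ) := by
  obtain ⟨f, -, hk⟩ := h.isCompatible
  exact isInner_of_frame hk

/-- The endomorphism `½ k⁻¹ k'` along which an inner product `k` with velocity `k'` is
transported. -/
def halfRaise (k k' : E7 →L[ℝ] E7 →L[ℝ] ℝ) : E7 →L[ℝ] E7 :=
  (1 / 2 : ℝ) • (k.inverse ∘L k')

theorem IsInner.halfRaise_apply {k : E7 →L[ℝ] E7 →L[ℝ] ℝ} (hk : IsInner k)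
    (k' : E7 →L[ℝ] E7 →L[ℝ] ℝ) (u v : E7) : k (halfRaise k k' u) v = (1 / 2) * k' u v := by
  simp [halfRaise, hk.inverse_apply]

theorem IsInner.half_raise {k : E7 →L[ℝ] E7 →L[ℝ] ℝ} (hk : IsInner k)
    (k' : E7 →L[ℝ] E7 →L[ℝ] ℝ) : (1 / 2 : ℝ) • raise k k' = halfRaise k k' := by
  rw [halfRaise, hk.raise_eq (S := k.inverse ∘L k')]
  intro u v
  exact hk.inverse_apply _ _

/-- `k` is a differentiable curve of inner products on `J`, with velocity `k'`. -/
structure IsInnerCurve (J : Set ℝ) (k k' : ℝ → E7 →L[ℝ] E7 →L[ℝ] ℝ) : Prop where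
  isInner : ∀ t ∈ J, IsInner (k t)
  hasDeriv : ∀ t ∈ J, HasDerivWithinAt k (k' t) J t
  symm : ∀ t ∈ J, ∀ u v, k' t u v = k' t v u

/-- `N` is the solution of `Ṅ = -½ k⁻¹ k̇ N`, `N 0 = 1`, on `J`. -/
structure IsTransport (J : Set ℝ) (k k' : ℝ → E7 →L[ℝ] E7 →L[ℝ] ℝ) (N : ℝ → E7 →L[ℝ] E7) :
    Prop where
  initial : N 0 = ContinuousLinearMap.id ℝ E7
  hasDeriv : ∀ t ∈ J, HasDerivWithinAt N (-(halfRaise (k t) (k' t) ∘L N t)) J t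

/-- `η` is a curve of positive forms solving `η̇ = (3/2) i_η(k')` on `J`. -/
structure IsFormSolution (J : Set ℝ) (k' : ℝ → E7 →L[ℝ] E7 →L[ℝ] ℝ)
    (η : ℝ → E7 [⋀^Fin 3]→L[ℝ] ℝ) : Prop where
  positive : ∀ t ∈ J, IsPositive (η t)
  hasDeriv : ∀ t ∈ J, HasDerivWithinAt η ((3 / 2 : ℝ) • iMap (η t) (k' t)) J t

section

variable {J : Set ℝ} {k k' : ℝ → E7 →L[ℝ] E7 →L[ℝ] ℝ} {N N₁ N₂ : ℝ → E7 →L[ℝ] E7}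
  {η : ℝ → E7 [⋀^Fin 3]→L[ℝ] ℝ}

theorem IsInnerCurve.mono {I : Set ℝ} (h : IsInnerCurve I k k') (hJ : J ⊆ I) :
    IsInnerCurve J k k' where
  isInner t ht := h.isInner t (hJ ht)
  hasDeriv t ht := HasFDerivWithinAt.mono (h.hasDeriv t (hJ ht)) hJ
  symm t ht := h.symm t (hJ ht)

theorem IsTransport.mono {I : Set ℝ} (h : IsTransport I k k' N) (hJ : J ⊆ I) :
    IsTransport J k k' N :=
  ⟨h.initial, fun t ht => (h.hasDeriv t (hJ ht)).mono hJ⟩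

theorem hasDerivWithinAt_inner_apply {t : ℝ} {K : ℝ → E7 →L[ℝ] E7 →L[ℝ] ℝ}
    {K' : E7 →L[ℝ] E7 →L[ℝ] ℝ} {a b : ℝ → E7} {a' b' : E7} (hK : HasDerivWithinAt K K' J t)
    (ha : HasDerivWithinAt a a' J t) (hb : HasDerivWithinAt b b' J t) :
    HasDerivWithinAt (fun s => K s (a s) (b s))
      (K' (a t) (b t) + K t a' (b t) + K t (a t) b') J t := by
  have := (hK.clm_apply ha).clm_apply hb
  simpa using this

/-- Transports carry `k 0` to `k t`. Stated for two transports, it also gives their uniqueness. -/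
theorem IsTransport.inner_eq (hJ : J.OrdConnected) (hJ0 : (0 : ℝ) ∈ J) (hk : IsInnerCurve J k k')
    (h₁ : IsTransport J k k' N₁) (h₂ : IsTransport J k k' N₂) {t : ℝ} (ht : t ∈ J) (u v : E7) :
    k t (N₁ t u) (N₂ t v) = k 0 u v := by
  have hder : ∀ s ∈ J, HasDerivWithinAt (fun s => k s (N₁ s u) (N₂ s v)) 0 J s := by
    intro s hs
    have h1 : HasDerivWithinAt (fun s => N₁ s u) (-(halfRaise (k s) (k' s) (N₁ s u))) J s := by
      simpa using (h₁.hasDeriv s hs).clm_apply (hasDerivWithinAt_const s J u)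
    have h2 : HasDerivWithinAt (fun s => N₂ s v) (-(halfRaise (k s) (k' s) (N₂ s v))) J s := by
      simpa using (h₂.hasDeriv s hs).clm_apply (hasDerivWithinAt_const s J v)
    refine (hasDerivWithinAt_inner_apply (hk.hasDeriv s hs) h1 h2).congr_deriv ?_
    have hi := hk.isInner s hs
    rw [map_neg, neg_apply, map_neg, hi.halfRaise_apply, hi.symm (N₁ s u),
      hi.halfRaise_apply, hk.symm s hs (N₂ s v)]
    ring
  rw [eq_of_hasDerivWithinAt_zero hJ hder hJ0 ht, h₁.initial, h₂.initial]
  rfl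

theorem IsTransport.isInvertible (hJ : J.OrdConnected) (hJ0 : (0 : ℝ) ∈ J)
    (hk : IsInnerCurve J k k') (h : IsTransport J k k' N) {t : ℝ} (ht : t ∈ J) :
    (N t).IsInvertible := by
  have hinj : Function.Injective (N t : E7 →ₗ[ℝ] E7) := fun a b hab =>
    (hk.isInner 0 hJ0).eq_of_forall fun v => by
      have hab' : N t a = N t b := hab
      rw [← h.inner_eq hJ hJ0 hk h ht, ← h.inner_eq hJ hJ0 hk h ht, hab']
  exact ⟨(LinearEquiv.ofInjectiveEndo _ hinj).toContinuousLinearEquiv, by ext; rfl⟩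

theorem IsTransport.unique (hJ : J.OrdConnected) (hJ0 : (0 : ℝ) ∈ J) (hk : IsInnerCurve J k k')
    (h₁ : IsTransport J k k' N₁) (h₂ : IsTransport J k k' N₂) {t : ℝ} (ht : t ∈ J) :
    N₁ t = N₂ t := by
  ext1 v
  refine (hk.isInner t ht).eq_of_forall fun w => ?_
  rw [← (h₁.isInvertible hJ hJ0 hk ht).self_apply_inverse w, h₁.inner_eq hJ hJ0 hk h₁ ht,
    (hk.isInner t ht).symm, h₁.inner_eq hJ hJ0 hk h₂ ht, (hk.isInner 0 hJ0).symm]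

/-- A solution of `η̇ = (3/2) i_η(ġ)` induces the metrics `g`, because the induced metric moves with
velocity `ġ`. -/
theorem IsFormSolution.inducedMetric_eq (hJ : J.OrdConnected) (hJ0 : (0 : ℝ) ∈ J)
    (hk : IsInnerCurve J k k') (h : IsFormSolution J k' η) (h0 : inducedMetric (η 0) = k 0)
    {t : ℝ} (ht : t ∈ J) : inducedMetric (η t) = k t := by
  ext u v
  have hder : ∀ s ∈ J, HasDerivWithinAt (fun s => inducedMetric (η s) u v - k s u v) 0 J s := by
    intro s hs
    have hη := h.hasDeriv s hs
    rw [three_halves_smul_iMap] at hη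
    have hi := (h.positive s hs).isInner
    rw [hi.half_raise] at hη
    have h1 := IsPositive.hasDerivWithinAt_inducedMetric hs h.positive hη u v
    have h2 := hasDerivWithinAt_inner_apply (hk.hasDeriv s hs) (hasDerivWithinAt_const s J u)
      (hasDerivWithinAt_const s J v)
    refine (h1.sub h2).congr_deriv ?_
    rw [hi.symm u, hi.halfRaise_apply, hi.halfRaise_apply, hk.symm s hs v]
    simp only [map_zero, zero_apply]
    ring
  have := eq_of_hasDerivWithinAt_zero hJ hder hJ0 ht
  rw [h0, sub_self, sub_eq_zero] at this
  exact this

/-- A solution is determined by its initial value: its pull-back by the transport is constant, as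
the metric that raises the index is known by `IsFormSolution.inducedMetric_eq`. -/
theorem IsFormSolution.eq_comp_inverse (hJ : J.OrdConnected) (hJ0 : (0 : ℝ) ∈ J)
    (hk : IsInnerCurve J k k') (h : IsFormSolution J k' η) (h0 : inducedMetric (η 0) = k 0)
    (hN : IsTransport J k k' N) {t : ℝ} (ht : t ∈ J) :
    η t = (η 0).compContinuousLinearMap (N t).inverse := by
  have hder : ∀ s ∈ J, HasDerivWithinAt (fun s => (η s).compContinuousLinearMap (N s)) 0 J s := by
    intro s hs
    have hη := h.hasDeriv s hs
    rw [three_halves_smul_iMap, (h.positive s hs).isInner.half_raise,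
      h.inducedMetric_eq hJ hJ0 hk h0 hs] at hη
    exact hasDerivWithinAt_compContinuousLinearMap_zero hη (hN.hasDeriv s hs)
  have hc := eq_of_hasDerivWithinAt_zero hJ hder hJ0 ht
  simp only [hN.initial] at hc
  have hinv := hN.isInvertible hJ hJ0 hk ht
  ext v
  have := congrArg (fun ψ : E7 [⋀^Fin 3]→L[ℝ] ℝ => ψ fun i => (N t).inverse (v i)) hc
  simp only [ContinuousAlternatingMap.compContinuousLinearMap_apply, Function.comp_def,
    hinv.self_apply_inverse] at this
  rw [this]
  rfl

theorem IsTransport.hasDerivWithinAt_inverse (hJ : J.OrdConnected) (hJ0 : (0 : ℝ) ∈ J)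
    (hk : IsInnerCurve J k k') (hN : IsTransport J k k' N) {t : ℝ} (ht : t ∈ J) :
    HasDerivWithinAt (fun s => (N s).inverse) ((N t).inverse ∘L halfRaise (k t) (k' t)) J t := by
  have hinv := hN.isInvertible hJ hJ0 hk ht
  obtain ⟨e, he⟩ := hinv
  let w : (E7 →L[ℝ] E7)ˣ := (ContinuousLinearEquiv.unitsEquiv ℝ E7).symm e
  have hw : (w : E7 →L[ℝ] E7) = N t := he
  have h1 := hasFDerivAt_ringInverse (𝕜 := ℝ) w
  rw [hw] at h1
  have h2 := h1.comp_hasDerivWithinAt t (hN.hasDeriv t ht)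
  rw [ContinuousLinearMap.ringInverse_eq_inverse] at h2
  refine h2.congr_deriv ?_
  have hw' : ((w⁻¹ : (E7 →L[ℝ] E7)ˣ) : E7 →L[ℝ] E7) = (N t).inverse := by
    rw [← he, ContinuousLinearMap.inverse_equiv]
    rfl
  rw [hw']
  ext v
  simp [ContinuousLinearMap.mulLeftRight_apply, hN.isInvertible hJ hJ0 hk ht]

/-- The pull-back of `φ` by the inverse transport solves the equation. -/
theorem IsTransport.isFormSolution (hJ : J.OrdConnected) (hJ0 : (0 : ℝ) ∈ J)
    (hk : IsInnerCurve J k k') (hN : IsTransport J k k' N) {φ : E7 [⋀^Fin 3]→L[ℝ] ℝ}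
    (hφ : IsPositive φ) (h0 : inducedMetric φ = k 0) :
    IsFormSolution J k' fun t => φ.compContinuousLinearMap (N t).inverse := by
  have hpos : ∀ t ∈ J, IsPositive (φ.compContinuousLinearMap (N t).inverse) := by
    intro t ht
    obtain ⟨e, he⟩ := hN.isInvertible hJ hJ0 hk ht
    rw [← he, ContinuousLinearMap.inverse_equiv]
    exact hφ.comp _
  refine ⟨hpos, fun t ht => ?_⟩
  have hmet : inducedMetric (φ.compContinuousLinearMap (N t).inverse) = k t := by
    have hinv := hN.isInvertible hJ hJ0 hk ht
    obtain ⟨e, he⟩ := hinv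
    ext u v
    have h1 := hN.inner_eq hJ hJ0 hk hN ht (e.symm u) (e.symm v)
    rw [← he] at h1 ⊢
    rw [ContinuousLinearMap.inverse_equiv, hφ.inducedMetric_comp, h0, ← h1]
    simp
  rw [three_halves_smul_iMap, (hpos t ht).isInner.half_raise, hmet,
    ← fderivCompContinuousLinearMap_comp']
  have := hasDerivWithinAt_compContinuousLinearMap (hasDerivWithinAt_const t J φ)
    (hN.hasDerivWithinAt_inverse hJ hJ0 hk ht)
  refine this.congr_deriv ?_
  rw [add_eq_right]
  rfl

end

/-! ### The metric square root -/

/-- A positive self-adjoint endomorphism of `ℝ⁷` has a positive self-adjoint square root. -/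
theorem exists_sqrt_of_isSymmetric (T : E7 →L[ℝ] E7)
    (hT : ∀ u v, inner ℝ (T u) v = inner ℝ u (T v)) (hpos : ∀ u, u ≠ 0 → 0 < inner ℝ (T u) u) :
    ∃ R : E7 →L[ℝ] E7, (∀ u v, inner ℝ (R u) v = inner ℝ u (R v)) ∧
      (∀ u, u ≠ 0 → 0 < inner ℝ (R u) u) ∧ ∀ u, R (R u) = T u := by
  have hsym : (T : E7 →ₗ[ℝ] E7).IsSymmetric := hT
  have hn : Module.finrank ℝ E7 = 7 := by simp
  set b := hsym.eigenvectorBasis hn with hb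
  set l := hsym.eigenvalues hn with hl
  have hTb : ∀ i, T (b i) = l i • b i := fun i => hsym.apply_eigenvectorBasis hn i
  have hl0 : ∀ i, 0 < l i := by
    intro i
    have h := hpos (b i) (b.orthonormal.ne_zero i)
    rwa [hTb, inner_smul_left, real_inner_self_eq_norm_sq, b.orthonormal.1 i, one_pow, mul_one] at h
  let R : E7 →L[ℝ] E7 := ∑ i, √(l i) • (innerSL ℝ (b i)).smulRight (b i)
  have hR : ∀ u, R u = ∑ i, (√(l i) * inner ℝ (b i) u) • b i := by
    intro u
    simp [R, smul_smul]
  have hRinner : ∀ u v, inner ℝ (R u) v = ∑ i, √(l i) * inner ℝ (b i) u * inner ℝ (b i) v := by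
    intro u v
    rw [hR, sum_inner]
    simp [inner_smul_left]
  refine ⟨R, fun u v => ?_, fun u hu => ?_, fun u => ?_⟩
  · rw [hRinner, real_inner_comm (R v) u, hRinner]
    exact Finset.sum_congr rfl fun i _ => by ring
  · rw [hRinner]
    have hex : ∃ i, inner ℝ (b i) u ≠ 0 := by
      by_contra! h
      rw [← b.sum_repr' u] at hu
      exact hu (Finset.sum_eq_zero fun i _ => by rw [h i, zero_smul])
    obtain ⟨i, hi⟩ := hex
    refine Finset.sum_pos' (fun j _ => ?_) ⟨i, Finset.mem_univ i, ?_⟩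
    · rw [mul_assoc]
      exact mul_nonneg (Real.sqrt_nonneg _) (mul_self_nonneg _)
    · rw [mul_assoc]
      exact mul_pos (Real.sqrt_pos.2 (hl0 i)) (mul_self_pos.2 hi)
  · have hRb : ∀ i, R (b i) = √(l i) • b i := by
      intro i
      rw [hR, Finset.sum_eq_single i]
      · rw [real_inner_self_eq_norm_sq, b.orthonormal.1 i, one_pow, mul_one]
      · intro j _ hj
        rw [b.orthonormal.2 hj, mul_zero, zero_smul]
      · simp
    have : (R ∘L R : E7 →L[ℝ] E7) = T := by
      ext1 x
      rw [← b.sum_repr x]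
      simp only [map_sum, map_smul]
      refine Finset.sum_congr rfl fun i _ => ?_
      rw [ContinuousLinearMap.comp_apply, hRb, map_smul, hRb, smul_smul,
        hTb, smul_smul, smul_smul, mul_assoc, Real.mul_self_sqrt (hl0 i).le]
    exact congrArg (fun A : E7 →L[ℝ] E7 => A u) this

theorem exists_isMetricRoot {g k : E7 →L[ℝ] E7 →L[ℝ] ℝ} {f : E7 ≃L[ℝ] E7} (hg : IsInner g)
    (hf : ∀ u v, k u v = inner ℝ (f u) (f v)) : ∃ B, IsMetricRoot g k B := by
  have hk := isInner_of_frame hf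
  have hA : ∀ u v, k (k.inverse (g u)) v = g u v := fun u v => hk.inverse_apply _ _
  let T : E7 →L[ℝ] E7 := (f : E7 →L[ℝ] E7) ∘L (k.inverse ∘L g) ∘L (f.symm : E7 →L[ℝ] E7)
  have hTi : ∀ x y, inner ℝ (T x) y = g (f.symm x) (f.symm y) := by
    intro x y
    rw [← hA, hf]
    simp [T]
  obtain ⟨R, hR1, hR2, hR3⟩ := exists_sqrt_of_isSymmetric T
    (fun u v => by rw [hTi, real_inner_comm, hTi, hg.symm])
    (fun u hu => by rw [hTi]; exact hg.pos _ (by simpa using hu))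
  refine ⟨(f.symm : E7 →L[ℝ] E7) ∘L R ∘L (f : E7 →L[ℝ] E7), fun u v => ?_, fun u hu => ?_,
    fun u v => ?_⟩
  · simp [hf, hR1]
  · simp only [hf, ContinuousLinearMap.comp_apply, ContinuousLinearEquiv.coe_coe,
      ContinuousLinearEquiv.apply_symm_apply]
    exact hR2 _ (by simpa using hu)
  · simp [hf, hR3, hTi]

theorem isMetricRoot_metricRoot {g k : E7 →L[ℝ] E7 →L[ℝ] ℝ} {f : E7 ≃L[ℝ] E7} (hg : IsInner g)
    (hf : ∀ u v, k u v = inner ℝ (f u) (f v)) : IsMetricRoot g k (metricRoot g k) :=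
  Classical.epsilon_spec (exists_isMetricRoot hg hf)

namespace IsMetricRoot

variable {g k : E7 →L[ℝ] E7 →L[ℝ] ℝ} {B : E7 →L[ℝ] E7}

theorem apply_ne_zero (h : IsMetricRoot g k B) {u : E7} (hu : u ≠ 0) : B u ≠ 0 := by
  intro h0
  have := h.2.1 u hu
  rw [h0] at this
  simp at this

/-- A metric root of `g` with respect to `k` is positive with respect to `g` as well. -/
theorem pos_left (h : IsMetricRoot g k B) {u : E7} (hu : u ≠ 0) : 0 < g u (B u) := by
  rw [h.2.2]
  exact h.2.1 _ (h.apply_ne_zero hu)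

theorem comp_self (h : IsMetricRoot g k B) (hk : IsInner k) : B ∘L B = k.inverse ∘L g := by
  ext1 u
  exact hk.eq_of_forall fun v => by
    rw [ContinuousLinearMap.comp_apply, ContinuousLinearMap.comp_apply, hk.inverse_apply, h.2.2]

theorem eq_id (h : IsMetricRoot g g B) (hg : IsInner g) : B = ContinuousLinearMap.id ℝ E7 := by
  have hBB : ∀ u, B (B u) = u := fun u => hg.eq_of_forall fun v => (h.2.2 u v).symm
  ext1 u
  rw [ContinuousLinearMap.id_apply]
  by_contra hne
  -- `w = B u - u` satisfies `B w = -w`, against positivity.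
  have hw : B u - u ≠ 0 := sub_ne_zero.2 hne
  have h1 : B (B u - u) = -(B u - u) := by rw [map_sub, hBB]; abel
  have h2 := h.2.1 _ hw
  rw [h1] at h2
  have h3 := hg.pos _ hw
  rw [show g (-(B u - u)) = -g (B u - u) from map_neg g _, neg_apply] at h2
  linarith

end IsMetricRoot

theorem exists_pos_bound {g : E7 →L[ℝ] E7 →L[ℝ] ℝ} {B : E7 →L[ℝ] E7}
    (h : ∀ u, u ≠ 0 → 0 < g u (B u)) : ∃ c > 0, ∀ u, c * ‖u‖ ^ 2 ≤ g u (B u) := by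
  have hc : ContinuousOn (fun u : E7 => g u (B u)) (Metric.sphere 0 1) := by fun_prop
  have hne : (Metric.sphere (0 : E7) 1).Nonempty := NormedSpace.sphere_nonempty.2 zero_le_one
  obtain ⟨u₀, hu₀, hmin⟩ := (isCompact_sphere (0 : E7) 1).exists_isMinOn hne hc
  have hu₀' : u₀ ≠ 0 := by
    rintro rfl
    simp at hu₀
  refine ⟨g u₀ (B u₀), h _ hu₀', fun u => ?_⟩
  by_cases hu : u = 0
  · simp [hu]
  have hn : ‖u‖ ≠ 0 := norm_ne_zero_iff.2 hu
  have h1 := hmin (show ‖u‖⁻¹ • u ∈ Metric.sphere (0 : E7) 1 by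
    simp [norm_smul, hn])
  simp only [mem_ofPred_eq, map_smul, smul_apply, smul_eq_mul] at h1
  calc g u₀ (B u₀) * ‖u‖ ^ 2 ≤ ‖u‖⁻¹ * (‖u‖⁻¹ * g u (B u)) * ‖u‖ ^ 2 := by gcongr
    _ = g u (B u) := by field_simp

section

variable {J : Set ℝ} {k k' : ℝ → E7 →L[ℝ] E7 →L[ℝ] ℝ} {B : ℝ → E7 →L[ℝ] E7}

theorem isInvertible_of_pos {g : E7 →L[ℝ] E7 →L[ℝ] ℝ} {X : E7 →L[ℝ] E7}
    (h : ∀ u, u ≠ 0 → 0 < g u (X u)) : X.IsInvertible := by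
  have hinj : Function.Injective (X : E7 →ₗ[ℝ] E7) := by
    rw [injective_iff_map_eq_zero]
    intro a ha
    by_contra h0
    have h1 := h a h0
    have h2 : X a = 0 := ha
    rw [h2, map_zero] at h1
    exact lt_irrefl _ h1
  exact ⟨(LinearEquiv.ofInjectiveEndo _ hinj).toContinuousLinearEquiv, by ext; rfl⟩

/-- A commuting curve of positive endomorphisms whose square is differentiable is differentiable,
because `B s - B t = (B s + B t)⁻¹ (B s ² - B t ²)`. -/
theorem hasDerivWithinAt_of_sq {g : E7 →L[ℝ] E7 →L[ℝ] ℝ} {t : ℝ} (ht : t ∈ J)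
    (hpos : ∀ s ∈ J, ∀ u, u ≠ 0 → 0 < g u (B s u))
    (hcomm : ∀ s ∈ J, B s * B t = B t * B s) {Q' : E7 →L[ℝ] E7}
    (hQ : HasDerivWithinAt (fun s => B s * B s) Q' J t) :
    HasDerivWithinAt B ((B t + B t).inverse * Q') J t := by
  have hXpos : ∀ s ∈ J, ∀ u, u ≠ 0 → 0 < g u ((B s + B t) u) := by
    intro s hs u hu
    rw [add_apply, map_add]
    exact add_pos (hpos s hs u hu) (hpos t ht u hu)
  have hX : ∀ s ∈ J, (B s + B t).IsInvertible := fun s hs => isInvertible_of_pos (hXpos s hs)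
  have hdiff : ∀ s ∈ J, B s - B t = (B s + B t).inverse * (B s * B s - B t * B t) := by
    intro s hs
    have h1 : B s * B s - B t * B t = (B s + B t) * (B s - B t) := by
      have := hcomm s hs
      rw [add_mul, mul_sub, mul_sub, this]
      abel
    rw [h1, ← mul_assoc]
    have h2 : (B s + B t).inverse * (B s + B t) = 1 := (hX s hs).inverse_comp_self
    rw [h2, one_mul]
  -- Uniform bound for the inverse of `B s + B t`.
  obtain ⟨c, hc, hcb⟩ := exists_pos_bound (hpos t ht)
  have hbound : ∀ s ∈ J, ‖(B s + B t).inverse‖ ≤ ‖g‖ / c := by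
    intro s hs
    refine ContinuousLinearMap.opNorm_le_bound _ (by positivity) fun w => ?_
    set u := (B s + B t).inverse w with hu
    have hw : (B s + B t) u = w := (hX s hs).self_apply_inverse w
    have h1 : c * ‖u‖ ^ 2 ≤ g u w := by
      have h2 : 0 ≤ g u (B s u) := by
        by_cases h0 : u = 0
        · simp [h0]
        · exact (hpos s hs u h0).le
      rw [← hw, add_apply, map_add]
      linarith [hcb u]
    have h3 : g u w ≤ ‖g‖ * ‖u‖ * ‖w‖ := (le_abs_self _).trans (g.le_opNorm₂ u w)
    by_cases h0 : ‖u‖ = 0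
    · rw [h0]; positivity
    · have hpu : 0 < ‖u‖ := lt_of_le_of_ne (norm_nonneg _) (Ne.symm h0)
      rw [div_mul_eq_mul_div, le_div_iff₀ hc]
      have : ‖u‖ * (‖u‖ * c) ≤ ‖u‖ * (‖g‖ * ‖w‖) := by nlinarith
      exact le_of_mul_le_mul_left this hpu
  have hQc : Tendsto (fun s => B s * B s - B t * B t) (𝓝[J] t) (𝓝 0) := by
    have := hQ.continuousWithinAt.tendsto.sub_const (B t * B t)
    simpa using this
  have hBc : Tendsto B (𝓝[J] t) (𝓝 (B t)) := by
    rw [tendsto_iff_norm_sub_tendsto_zero]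
    have hlim : Tendsto (fun s => ‖g‖ / c * ‖B s * B s - B t * B t‖) (𝓝[J] t) (𝓝 0) := by
      simpa using (hQc.norm).const_mul (‖g‖ / c)
    refine squeeze_zero' (Eventually.of_forall fun s => norm_nonneg _) ?_ hlim
    filter_upwards [self_mem_nhdsWithin] with s hs
    rw [hdiff s hs]
    exact (norm_mul_le _ _).trans (mul_le_mul_of_nonneg_right (hbound s hs) (norm_nonneg _))
  have hXc : Tendsto (fun s => (B s + B t).inverse) (𝓝[J] t) (𝓝 (B t + B t).inverse) :=
    ((hX t ht).contDiffAt_map_inverse (𝕜 := ℝ) (n := 0)).continuousAt.tendsto.comp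
      (hBc.add_const (B t))
  rw [hasDerivWithinAt_iff_tendsto_slope] at hQ ⊢
  refine ((hXc.mono_left (nhdsWithin_mono _ sdiff_subset)).mul hQ).congr' ?_
  filter_upwards [self_mem_nhdsWithin] with s hs
  rw [slope_def_module, slope_def_module, hdiff s hs.1]
  exact ContinuousLinearMap.comp_smul _ _ _

theorem IsInnerCurve.hasDerivWithinAt_inverse_comp (hJ : UniqueDiffOn ℝ J)
    (hk : IsInnerCurve J k k') (g : E7 →L[ℝ] E7 →L[ℝ] ℝ) {t : ℝ} (ht : t ∈ J) :
    HasDerivWithinAt (fun s => (k s).inverse ∘L g)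
      (-((2 : ℝ) • (halfRaise (k t) (k' t) ∘L ((k t).inverse ∘L g)))) J t := by
  have hi := hk.isInner t ht
  have hinv : DifferentiableWithinAt ℝ (fun s => (k s).inverse) J t :=
    ((hi.isInvertible.contDiffAt_map_inverse (𝕜 := ℝ) (n := 1)).differentiableAt
      one_ne_zero).comp_differentiableWithinAt t (hk.hasDeriv t ht).differentiableWithinAt
  obtain ⟨P', hP⟩ : ∃ P', HasDerivWithinAt (fun s => (k s).inverse) P' J t :=
    ⟨_, HasFDerivWithinAt.hasDerivWithinAt (F := (E7 →L[ℝ] ℝ) →L[ℝ] E7) hinv.hasFDerivWithinAt⟩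
  have hP' : HasDerivWithinAt (fun s => (k s).inverse ∘L g) (P' ∘L g) J t := by
    simpa using hP.clm_comp (hasDerivWithinAt_const t J g)
  refine HasDerivWithinAt.congr_deriv (F := E7 →L[ℝ] E7) hP' ?_
  ext1 u
  refine hi.eq_of_forall fun v => ?_
  -- Differentiate `k (k⁻¹ (g u)) v = g u v`.
  have h1 := hasDerivWithinAt_inner_apply (hk.hasDeriv t ht)
    (hP.clm_apply (hasDerivWithinAt_const t J (g u))) (hasDerivWithinAt_const t J v)
  have h2 : HasDerivWithinAt (fun s => k s ((k s).inverse (g u)) v) 0 J t := by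
    refine (hasDerivWithinAt_const t J (g u v)).congr (fun s hs => ?_) ?_
    · exact (hk.isInner s hs).inverse_apply _ _
    · exact hi.inverse_apply _ _
  have h3 := (hJ t ht).eq_deriv J h1 h2
  simp only [map_zero, add_zero] at h3
  rw [neg_apply, smul_apply, map_neg, neg_apply, map_smul, smul_apply,
    ContinuousLinearMap.comp_apply, ContinuousLinearMap.comp_apply, hi.halfRaise_apply,
    ContinuousLinearMap.comp_apply, smul_eq_mul]
  linarith

/-- Commuting metric roots are the transport. Differentiating `B² = k⁻¹ k₀` gives
`B Ḃ + Ḃ B = -k⁻¹ k̇ B²`, and the commutation of `Ḃ` with `B` turns this into `Ḃ = -½ k⁻¹ k̇ B`. -/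
theorem IsInnerCurve.isTransport_metricRoot (hJ : UniqueDiffOn ℝ J)
    (hk : IsInnerCurve J k k') (hJ0 : (0 : ℝ) ∈ J)
    (hB : ∀ t ∈ J, IsMetricRoot (k 0) (k t) (B t))
    (hcomm : ∀ s ∈ J, ∀ t ∈ J, B s ∘L B t = B t ∘L B s) : IsTransport J k k' B := by
  refine ⟨(hB 0 hJ0).eq_id (hk.isInner 0 hJ0), fun t ht => ?_⟩
  set A := halfRaise (k t) (k' t) with hA
  have hQ : HasDerivWithinAt (fun s => B s * B s) (-((2 : ℝ) • (A ∘L (B t * B t)))) J t := by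
    have h1 := hk.hasDerivWithinAt_inverse_comp hJ (k 0) ht
    rw [← (hB t ht).comp_self (hk.isInner t ht)] at h1
    refine HasDerivWithinAt.congr (F := E7 →L[ℝ] E7) h1
      (fun s hs => (hB s hs).comp_self (hk.isInner s hs)) ((hB t ht).comp_self (hk.isInner t ht))
  have hD := hasDerivWithinAt_of_sq (g := k 0) ht (fun s hs u hu => (hB s hs).pos_left hu)
    (fun s hs => hcomm s hs t ht) hQ
  set D := (B t + B t).inverse * (-((2 : ℝ) • (A ∘L (B t * B t)))) with hDdef
  have hinv : (B t).IsInvertible := isInvertible_of_pos fun u hu => (hB t ht).pos_left hu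
  have h2inv : (B t + B t).IsInvertible := isInvertible_of_pos (g := k 0) fun u hu => by
    rw [add_apply, map_add]
    exact add_pos ((hB t ht).pos_left hu) ((hB t ht).pos_left hu)
  -- The derivative commutes with `B t`.
  have hDB : ∀ u, B t (D u) = D (B t u) := by
    intro u
    have h1 : HasDerivWithinAt (fun s => B t (B s u)) (B t (D u)) J t := by
      simpa using (hasDerivWithinAt_const t J (B t)).clm_apply
        (hD.clm_apply (hasDerivWithinAt_const t J u))
    have h2 : HasDerivWithinAt (fun s => B s (B t u)) (D (B t u)) J t := by
      simpa using hD.clm_apply (hasDerivWithinAt_const t J (B t u))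
    have h3 : HasDerivWithinAt (fun s => B t (B s u)) (D (B t u)) J t :=
      h2.congr (fun s hs => congrArg (fun X : E7 →L[ℝ] E7 => X u) (hcomm t ht s hs)) rfl
    exact (hJ t ht).eq_deriv J h1 h3
  have hBD : (B t + B t) * D = -((2 : ℝ) • (A ∘L (B t * B t))) := by
    rw [hDdef, ← mul_assoc]
    have : (B t + B t) * (B t + B t).inverse = 1 := h2inv.self_comp_inverse
    rw [this, one_mul]
  have hDBt : ∀ u, D (B t u) = -A (B t (B t u)) := by
    intro u
    have h4 : B t (D u) + B t (D u) = -((2 : ℝ) • A (B t (B t u))) :=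
      congrArg (fun X : E7 →L[ℝ] E7 => X u) hBD
    rw [hDB, ← two_smul ℝ (D (B t u)), ← smul_neg] at h4
    exact smul_right_injective E7 (two_ne_zero (α := ℝ)) h4
  refine HasDerivWithinAt.congr_deriv (F := E7 →L[ℝ] E7) hD ?_
  ext1 u
  have := hDBt ((B t).inverse u)
  rw [hinv.self_apply_inverse] at this
  exact this

end

end

section

open Filter Topology unitInterval

/-! ### Linear differential equations with parameters -/

section Volterra

variable {R : Type*} [NormedRing R] [NormedAlgebra ℝ R]

/-- The primitive `s ↦ ∫₀ˢ f` on the unit interval. -/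
def primitive : C(I, R) →L[ℝ] C(I, R) :=
  LinearMap.mkContinuous
    { toFun := fun f => ⟨fun s => ∫ r in (0 : ℝ)..s, f (projIcc 0 1 zero_le_one r), by
        have hc : Continuous fun r : ℝ => f (projIcc 0 1 zero_le_one r) := by fun_prop
        exact (intervalIntegral.continuous_primitive
          (fun a b => hc.intervalIntegrable a b) 0).comp continuous_subtype_val⟩
      map_add' := fun f g => by
        ext s
        exact intervalIntegral.integral_add
          ((by fun_prop : Continuous _).intervalIntegrable _ _)
          ((by fun_prop : Continuous _).intervalIntegrable _ _)
      map_smul' := fun c f => by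
        ext s
        exact intervalIntegral.integral_smul c _ } 1 (fun f => by
    rw [one_mul, ContinuousMap.norm_le _ (norm_nonneg _)]
    intro s
    refine (intervalIntegral.norm_integral_le_of_norm_le_const (C := ‖f‖)
      (fun r _ => f.norm_coe_le_norm _)).trans ?_
    rw [sub_zero, abs_of_nonneg s.2.1]
    exact mul_le_of_le_one_right (norm_nonneg _) s.2.2)

/-- The Volterra operator `h ↦ (s ↦ ∫₀ˢ a h)`. -/
def volterra : C(I, R) →L[ℝ] C(I, R) →L[ℝ] C(I, R) :=
  (ContinuousLinearMap.compL ℝ C(I, R) C(I, R) C(I, R) primitive).comp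
    (ContinuousLinearMap.mul ℝ C(I, R))

theorem volterra_apply (a h : C(I, R)) (s : I) :
    volterra a h s = ∫ r in (0 : ℝ)..s,
      a (projIcc 0 1 zero_le_one r) * h (projIcc 0 1 zero_le_one r) := rfl

/-- Multiplication by `s ↦ exp (c s)`. -/
def expWeight (c : ℝ) : C(I, R) →L[ℝ] C(I, R) :=
  ContinuousLinearMap.mul ℝ C(I, R)
    ⟨fun s : I => algebraMap ℝ R (Real.exp (c * s)), by fun_prop⟩

theorem expWeight_apply (c : ℝ) (h : C(I, R)) (s : I) :
    expWeight c h s = Real.exp (c * s) • h s := by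
  rw [Algebra.smul_def]
  rfl

theorem expWeight_mul_neg (c : ℝ) : (expWeight c * expWeight (-c) : C(I, R) →L[ℝ] C(I, R)) = 1 := by
  ext h s
  change expWeight c (expWeight (-c) h) s = h s
  rw [expWeight_apply, expWeight_apply, smul_smul, ← Real.exp_add]
  simp

variable [CompleteSpace R]

/-- `1 - K` is invertible for every Volterra operator `K`: conjugation by a large exponential weight
makes the norm of `K` less than one. -/
theorem isUnit_one_sub_volterra (a : C(I, R)) :
    IsUnit (1 - volterra a : C(I, R) →L[ℝ] C(I, R)) := by
  set c : ℝ := ‖a‖ + 1 with hc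
  have hc0 : 0 < c := by positivity
  have hnorm : ‖(expWeight (-c) * volterra a * expWeight c : C(I, R) →L[ℝ] C(I, R))‖ ≤ ‖a‖ / c := by
    refine ContinuousLinearMap.opNorm_le_bound _ (by positivity) fun h => ?_
    rw [ContinuousMap.norm_le _ (by positivity)]
    intro s
    change ‖expWeight (-c) (volterra a (expWeight c h)) s‖ ≤ _
    rw [expWeight_apply, norm_smul, volterra_apply, Real.norm_eq_abs, Real.abs_exp]
    have hint : ‖∫ r in (0 : ℝ)..s, a (projIcc 0 1 zero_le_one r) *
        expWeight c h (projIcc 0 1 zero_le_one r)‖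
          ≤ ∫ r in (0 : ℝ)..s, ‖a‖ * ‖h‖ * Real.exp (c * r) := by
      refine intervalIntegral.norm_integral_le_of_norm_le s.2.1 ?_ (by
        exact (by fun_prop : Continuous _).intervalIntegrable _ _)
      refine Eventually.of_forall fun r hr => ?_
      have hr' : r ∈ Icc (0 : ℝ) 1 := ⟨hr.1.le, hr.2.trans s.2.2⟩
      refine (norm_mul_le _ _).trans ?_
      rw [expWeight_apply, norm_smul, Real.norm_eq_abs, Real.abs_exp, projIcc_of_mem _ hr',
        mul_assoc, mul_comm (Real.exp _)]
      gcongr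
      · exact a.norm_coe_le_norm _
      · exact h.norm_coe_le_norm _
    have hval : ∫ r in (0 : ℝ)..s, ‖a‖ * ‖h‖ * Real.exp (c * r)
        = ‖a‖ * ‖h‖ * (c⁻¹ * (Real.exp (c * s) - 1)) := by
      rw [intervalIntegral.integral_const_mul, intervalIntegral.integral_comp_mul_left _ hc0.ne']
      simp
    rw [hval] at hint
    calc Real.exp (-c * s) * _
        ≤ Real.exp (-c * s) * (‖a‖ * ‖h‖ * (c⁻¹ * (Real.exp (c * s) - 1))) := by gcongr
      _ = ‖a‖ / c * ‖h‖ * (1 - Real.exp (-c * s)) := by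
          have : Real.exp (-c * s) * Real.exp (c * s) = 1 := by
            rw [← Real.exp_add]; simp
          linear_combination (‖a‖ * ‖h‖ * c⁻¹) * this
      _ ≤ ‖a‖ / c * ‖h‖ := mul_le_of_le_one_right (by positivity) (by
          linarith [Real.exp_pos (-c * s)])
  have hlt : ‖(expWeight (-c) * volterra a * expWeight c : C(I, R) →L[ℝ] C(I, R))‖ < 1 := by
    refine hnorm.trans_lt ?_
    rw [div_lt_one hc0, hc]
    linarith
  have h1 : (expWeight c * expWeight (-c) : C(I, R) →L[ℝ] C(I, R)) = 1 := expWeight_mul_neg c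
  have h2 : (expWeight (-c) * expWeight c : C(I, R) →L[ℝ] C(I, R)) = 1 := by
    simpa using expWeight_mul_neg (R := R) (-c)
  let w : (C(I, R) →L[ℝ] C(I, R))ˣ := ⟨expWeight c, expWeight (-c), h1, h2⟩
  have hu : IsUnit (1 - expWeight (-c) * volterra a * expWeight c : C(I, R) →L[ℝ] C(I, R)) :=
    isUnit_one_sub_of_norm_lt_one (R := C(I, R) →L[ℝ] C(I, R)) hlt
  have hconj : ∀ {A : Type _} [Ring A] {e e' v : A}, e * e' = 1 →
      1 - v = e * (1 - e' * v * e) * e' := by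
    intro A _ e e' v he
    have h3 : e * (e' * v * e) * e' = (e * e') * v * (e * e') := by simp only [mul_assoc]
    rw [mul_sub, sub_mul, h3, mul_one, he, one_mul, mul_one]
  have hw : (1 - volterra a : C(I, R) →L[ℝ] C(I, R)) =
      (w : C(I, R) →L[ℝ] C(I, R)) * (1 - expWeight (-c) * volterra a * expWeight c) *
        ((w⁻¹ : (C(I, R) →L[ℝ] C(I, R))ˣ) : C(I, R) →L[ℝ] C(I, R)) :=
    hconj (A := C(I, R) →L[ℝ] C(I, R)) h1
  rw [hw]
  exact (w.isUnit.mul hu).mul w⁻¹.isUnit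

/-- The solution of `h = 1 + ∫ a h` on the unit interval. -/
def volterraSol (a : C(I, R)) : C(I, R) :=
  Ring.inverse (1 - volterra a : C(I, R) →L[ℝ] C(I, R)) 1

theorem volterraSol_unique {a h : C(I, R)} (hh : h = 1 + volterra a h) : h = volterraSol a := by
  have h1 : (1 - volterra a : C(I, R) →L[ℝ] C(I, R)) h = 1 := by
    change h - volterra a h = 1
    rw [sub_eq_iff_eq_add]
    exact hh
  have h2 := Ring.inverse_mul_cancel _ (isUnit_one_sub_volterra a)
  rw [volterraSol, ← h1]
  exact (congrArg (fun X : C(I, R) →L[ℝ] C(I, R) => X h) h2).symm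

theorem volterraSol_eq (a : C(I, R)) : volterraSol a = 1 + volterra a (volterraSol a) := by
  have h2 := Ring.mul_inverse_cancel _ (isUnit_one_sub_volterra a)
  have h3 : volterraSol a - volterra a (volterraSol a) = 1 :=
    congrArg (fun X : C(I, R) →L[ℝ] C(I, R) => X 1) h2
  exact sub_eq_iff_eq_add.1 h3

theorem contDiff_volterraSol {n : WithTop ℕ∞} :
    ContDiff ℝ n (volterraSol : C(I, R) → C(I, R)) := by
  rw [contDiff_iff_contDiffAt]
  intro a
  let w := (isUnit_one_sub_volterra a).unit
  have hw : (w : C(I, R) →L[ℝ] C(I, R)) = 1 - volterra a := rfl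
  have h1 : ContDiffAt ℝ n (Ring.inverse : (C(I, R) →L[ℝ] C(I, R)) → _) (1 - volterra a) := by
    rw [← hw]
    exact contDiffAt_ringInverse (R := C(I, R) →L[ℝ] C(I, R)) ℝ w
  have h2 : ContDiffAt ℝ n (fun a : C(I, R) => (1 - volterra a : C(I, R) →L[ℝ] C(I, R))) a :=
    contDiffAt_const.sub (by fun_prop)
  exact (h1.comp a h2).clm_apply contDiffAt_const

end Volterra

section Curry

universe u

/-- A continuous family of linear maps, as a linear map to continuous functions. -/
def flipEval (E F : Type u) [NormedAddCommGroup E] [NormedSpace ℝ E] [NormedAddCommGroup F]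
    [NormedSpace ℝ F] : C(I, E →L[ℝ] F) →L[ℝ] E →L[ℝ] C(I, F) :=
  LinearMap.mkContinuous₂
    (LinearMap.mk₂ ℝ
      (fun (w : C(I, E →L[ℝ] F)) (v : E) => (⟨fun s => w s v, by fun_prop⟩ : C(I, F)))
      (fun _ _ _ => by ext; rfl) (fun _ _ _ => by ext; rfl)
      (fun w v v' => by ext s; exact map_add (w s) v v')
      (fun c w v => by ext s; exact map_smul (w s) c v)) 1 (fun w v => by
    rw [one_mul, ContinuousMap.norm_le _ (by positivity)]
    intro s
    exact (ContinuousLinearMap.le_opNorm _ _).trans (by gcongr; exact w.norm_coe_le_norm s))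

/-- A jointly continuous map is continuous as a map into continuous functions of `s`. -/
theorem continuousOn_curry {E F : Type u} [NormedAddCommGroup E] [NormedAddCommGroup F]
    {P : Set E} {f : ℝ × E → F} (hf : ContinuousOn f (Icc (0 : ℝ) 1 ×ˢ P)) {G : E → C(I, F)}
    (hG : ∀ p ∈ P, ∀ s : I, G p s = f (s, p)) : ContinuousOn G P := by
  rw [continuousOn_iff_continuous_domRestrict]
  let g : C(P × I, F) := ⟨fun q => f (q.2, q.1), by
    refine hf.comp_continuous (by fun_prop) fun q => ⟨q.2.2, q.1.2⟩⟩
  have : P.domRestrict G = g.curry := by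
    ext p s
    exact hG p p.2 s
  rw [this]
  exact g.curry.continuous

theorem exists_curry {E F : Type u} [NormedAddCommGroup E] [NormedAddCommGroup F]
    {P : Set E} {f : ℝ × E → F} (hf : ContinuousOn f (Icc (0 : ℝ) 1 ×ˢ P)) :
    ∃ G : E → C(I, F), ∀ p ∈ P, ∀ s : I, G p s = f (s, p) := by
  classical
  have h : ∀ p ∈ P, Continuous fun s : I => f (s, p) := fun p hp =>
    hf.comp_continuous (by fun_prop) fun s => ⟨s.2, hp⟩
  exact ⟨fun p => if hp : p ∈ P then ⟨fun s : I => f (s, p), h p hp⟩ else 0,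
    fun p hp s => by simp [hp]⟩

/-- A map of class `C^n` in `(s, p)` is of class `C^n` as a map from `p` to functions of `s`. -/
theorem contDiffOn_curry {E : Type u} [NormedAddCommGroup E] [NormedSpace ℝ E] {P : Set E}
    (hP : Convex ℝ P) (hPu : UniqueDiffOn ℝ P) (n : ℕ) : ∀ {F : Type u} [NormedAddCommGroup F]
    [NormedSpace ℝ F] {f : ℝ × E → F} {G : E → C(I, F)}, ContDiffOn ℝ n f (Icc (0 : ℝ) 1 ×ˢ P) →
    (∀ p ∈ P, ∀ s : I, G p s = f (s, p)) → ContDiffOn ℝ n G P := by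
  have hS : UniqueDiffOn ℝ (Icc (0 : ℝ) 1 ×ˢ P) := (uniqueDiffOn_Icc zero_lt_one).prod hPu
  induction n with
  | zero =>
    intro F _ _ f G hf hG
    exact contDiffOn_zero.2 (continuousOn_curry hf.continuousOn hG)
  | succ n ih =>
    intro F _ _ f G hf hG
    set f' : ℝ × E → E →L[ℝ] F := fun q =>
      (fderivWithin ℝ f (Icc (0 : ℝ) 1 ×ˢ P) q).comp (ContinuousLinearMap.inr ℝ ℝ E) with hf'
    have hf'd : ContDiffOn ℝ n f' (Icc (0 : ℝ) 1 ×ˢ P) :=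
      (hf.fderivWithin hS (by norm_cast)).clm_comp contDiffOn_const
    obtain ⟨G', hG'⟩ := exists_curry hf'd.continuousOn
    have hG'd : ContDiffOn ℝ n G' P := ih hf'd hG'
    have hpart : ∀ s : I, ∀ p ∈ P, HasFDerivWithinAt (fun q => f (s, q)) (f' (s, p)) P p := by
      intro s p hp
      have h1 := (hf.differentiableOn (by simp) (s, p) ⟨s.2, hp⟩).hasFDerivWithinAt
      have h2 : HasFDerivWithinAt (fun q : E => ((s : ℝ), q)) (ContinuousLinearMap.inr ℝ ℝ E) P p :=
        (hasFDerivAt_prodMk_right (s : ℝ) p).hasFDerivWithinAt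
      exact h1.comp p h2 fun q hq => ⟨s.2, hq⟩
    have hder : ∀ p ∈ P, HasFDerivWithinAt G (flipEval E F (G' p)) P p := by
      intro p hp
      rw [hasFDerivWithinAt_iff_isLittleO, Asymptotics.isLittleO_iff]
      intro ε hε
      have hcont := hG'd.continuousOn p hp
      obtain ⟨δ, hδ, hδP⟩ := Metric.continuousWithinAt_iff.1 hcont ε hε
      filter_upwards [self_mem_nhdsWithin, mem_nhdsWithin_of_mem_nhds (Metric.ball_mem_nhds p hδ)]
        with q hq hqδ
      rw [ContinuousMap.norm_le _ (by positivity)]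
      intro s
      have hconv : Convex ℝ (P ∩ Metric.ball p δ) := hP.inter (convex_ball p δ)
      have hbd : ∀ x ∈ P ∩ Metric.ball p δ, ‖f' (s, x) - f' (s, p)‖ ≤ ε := by
        intro x hx
        rw [← hG' x hx.1 s, ← hG' p hp s]
        have h1 := (hδP hx.1 hx.2).le
        rw [dist_eq_norm] at h1
        exact ((G' x - G' p).norm_coe_le_norm s).trans h1
      have hmv := hconv.norm_image_sub_le_of_norm_hasFDerivWithin_le'
        (fun x hx => (hpart s x hx.1).mono inter_subset_left) hbd
        ⟨hp, Metric.mem_ball_self hδ⟩ ⟨hq, hqδ⟩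
      simpa [flipEval, hG' p hp, hG p hp, hG q hq] using hmv
    have hcast : ((n + 1 : ℕ) : WithTop ℕ∞) = (n : WithTop ℕ∞) + 1 := by norm_cast
    rw [hcast, contDiffOn_succ_iff_fderivWithin hPu]
    refine ⟨fun p hp => (hder p hp).differentiableWithinAt, by simp, ?_⟩
    have : ContDiffOn ℝ n (fun p => flipEval E F (G' p)) P :=
      by fun_prop
    exact this.congr fun p hp => (hder p hp).fderivWithin (hPu p hp)

end Curry

section LinearODE

/-- The fundamental theorem of calculus relative to an interval, which need not be open. -/
theorem hasDerivWithinAt_integral {F : Type*} [NormedAddCommGroup F] [NormedSpace ℝ F]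
    [CompleteSpace F] {J : Set ℝ} (hJ : J.OrdConnected) (hJ0 : (0 : ℝ) ∈ J) {f : ℝ → F}
    (hf : ContinuousOn f J) {t : ℝ} (ht : t ∈ J) :
    HasDerivWithinAt (fun u => ∫ s in (0 : ℝ)..u, f s) (f t) J t := by
  have hint : ∀ a ∈ J, ∀ b ∈ J, IntervalIntegrable f MeasureTheory.volume a b :=
    fun a ha b hb => (hf.mono (hJ.uIcc_subset ha hb)).intervalIntegrable
  rw [hasDerivWithinAt_iff_isLittleO, Asymptotics.isLittleO_iff]
  intro ε hε
  obtain ⟨δ, hδ, hδJ⟩ := Metric.continuousWithinAt_iff.1 (hf t ht) ε hε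
  filter_upwards [self_mem_nhdsWithin, mem_nhdsWithin_of_mem_nhds (Metric.ball_mem_nhds t hδ)]
    with u hu huδ
  have h1 : (∫ s in (0 : ℝ)..u, f s) - (∫ s in (0 : ℝ)..t, f s) - (u - t) • f t
      = ∫ s in t..u, (f s - f t) := by
    rw [intervalIntegral.integral_interval_sub_left (hint 0 hJ0 u hu) (hint 0 hJ0 t ht),
      intervalIntegral.integral_sub (hint t ht u hu) intervalIntegrable_const,
      intervalIntegral.integral_const]
  rw [h1]
  refine intervalIntegral.norm_integral_le_of_norm_le_const fun s hs => ?_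
  have hs' := uIoc_subset_uIcc hs
  have hball : uIcc t u ⊆ Metric.ball t δ := by
    rw [Real.ball_eq_Ioo]
    refine ordConnected_Ioo.uIcc_subset ?_ ?_ <;> rw [← Real.ball_eq_Ioo]
    exacts [Metric.mem_ball_self hδ, huδ]
  have := (hδJ (hJ.uIcc_subset ht hu hs') (hball hs')).le
  rwa [dist_eq_norm] at this

universe u

variable {R E : Type u} [NormedRing R] [NormedAlgebra ℝ R] [CompleteSpace R]
  [NormedAddCommGroup E] [NormedSpace ℝ E]

theorem mul_mem_of_mem_unitInterval {J : Set ℝ} (hJ : J.OrdConnected) (hJ0 : (0 : ℝ) ∈ J) {t : ℝ}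
    (ht : t ∈ J) {s : ℝ} (hs : s ∈ Icc (0 : ℝ) 1) : s * t ∈ J := by
  have := hJ.convex hJ0 ht (sub_nonneg.2 hs.2) hs.1 (by ring)
  simpa using this

/-- A linear differential equation `N' = A N`, `N 0 = 1`, whose coefficient depends smoothly on time
and on a parameter, has a solution on the whole time interval, smooth in time and parameter.
Rescaling time by `t` turns the value at `t` into the value at `1` of the solution of a Volterra
equation on the unit interval, which depends smoothly on its coefficient. -/
theorem exists_linear_ode {J : Set ℝ} (hJ : J.OrdConnected) (hJ0 : (0 : ℝ) ∈ J)
    (hJu : UniqueDiffOn ℝ J) {U : Set E} (hU : Convex ℝ U) (hUo : IsOpen U) {A : ℝ × E → R}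
    (hA : ContDiffOn ℝ ∞ A (J ×ˢ U)) :
    ∃ N : ℝ × E → R, ContDiffOn ℝ ∞ N (J ×ˢ U) ∧ (∀ y ∈ U, N (0, y) = 1) ∧
      ∀ t ∈ J, ∀ y ∈ U, HasDerivWithinAt (fun s => N (s, y)) (A (t, y) * N (t, y)) J t := by
  set f : ℝ × (ℝ × E) → R := fun q => q.2.1 • A (q.1 * q.2.1, q.2.2) with hf
  have hmaps : MapsTo (fun q : ℝ × (ℝ × E) => (q.1 * q.2.1, q.2.2)) (Icc (0 : ℝ) 1 ×ˢ (J ×ˢ U))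
      (J ×ˢ U) := fun q hq => ⟨mul_mem_of_mem_unitInterval hJ hJ0 hq.2.1 hq.1, hq.2.2⟩
  have hfd : ContDiffOn ℝ ∞ f (Icc (0 : ℝ) 1 ×ˢ (J ×ˢ U)) :=
    (by fun_prop : ContDiff ℝ ∞ fun q : ℝ × (ℝ × E) => q.2.1).contDiffOn.smul
      (hA.comp (by fun_prop : ContDiff ℝ ∞ _).contDiffOn hmaps)
  obtain ⟨G, hG⟩ := exists_curry hfd.continuousOn
  have hGd : ContDiffOn ℝ ∞ G (J ×ˢ U) := contDiffOn_infty.2 fun n =>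
    contDiffOn_curry (hJ.convex.prod hU) (hJu.prod hUo.uniqueDiffOn) n
      (hfd.of_le (by exact_mod_cast le_top)) hG
  set N : ℝ × E → R := fun p => volterraSol (G p) 1 with hN
  have hNd : ContDiffOn ℝ ∞ N (J ×ˢ U) :=
    (by fun_prop : ContDiff ℝ ∞ (ContinuousMap.evalCLM ℝ (1 : I) : C(I, R) →L[ℝ] R)).comp_contDiffOn
      (contDiff_volterraSol.comp_contDiffOn hGd)
  -- the solution for the parameter `t` at time `s` is the solution for `s t` at time `1`
  have hscale : ∀ t ∈ J, ∀ y ∈ U, ∀ s : I, volterraSol (G (t, y)) s = N (s * t, y) := by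
    intro t ht y hy s
    let w : C(I, R) := ⟨fun ρ => volterraSol (G (t, y)) (s * ρ), by fun_prop⟩
    have hw : w = volterraSol (G (s * t, y)) := by
      refine volterraSol_unique ?_
      ext ρ
      change volterraSol (G (t, y)) (s * ρ) = 1 + volterra (G (s * t, y)) w ρ
      rw [volterraSol_eq, ContinuousMap.add_apply, ContinuousMap.one_apply, volterra_apply,
        volterra_apply]
      congr 1
      have h1 := intervalIntegral.smul_integral_comp_mul_left (a := 0) (b := (ρ : ℝ))
        (fun r => G (t, y) (projIcc 0 1 zero_le_one r) *
          volterraSol (G (t, y)) (projIcc 0 1 zero_le_one r)) (s : ℝ)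
      rw [mul_zero] at h1
      change ∫ r in (0 : ℝ)..(s * ρ : ℝ), _ = _
      rw [← h1, ← intervalIntegral.integral_smul]
      refine intervalIntegral.integral_congr fun r hr => ?_
      rw [uIcc_of_le ρ.2.1] at hr
      have hrI : r ∈ Icc (0 : ℝ) 1 := ⟨hr.1, hr.2.trans ρ.2.2⟩
      have hsr : (s : ℝ) * r ∈ Icc (0 : ℝ) 1 :=
        ⟨mul_nonneg s.2.1 hrI.1, mul_le_one₀ s.2.2 hrI.1 hrI.2⟩
      have hst : ((s : ℝ) * t, y) ∈ J ×ˢ U := ⟨mul_mem_of_mem_unitInterval hJ hJ0 ht s.2, hy⟩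
      simp only [projIcc_of_mem _ hrI, projIcc_of_mem _ hsr]
      rw [hG _ hst, hG (t, y) ⟨ht, hy⟩, ← smul_mul_assoc]
      congr 1
      simp only [hf, smul_smul]
      rw [mul_comm (s : ℝ) r, mul_assoc]
    have := congrArg (fun h : C(I, R) => h 1) hw
    simpa [w] using this
  have hint : ∀ t ∈ J, ∀ y ∈ U, N (t, y) = 1 + ∫ r in (0 : ℝ)..t, A (r, y) * N (r, y) := by
    intro t ht y hy
    have h1 := intervalIntegral.smul_integral_comp_mul_right (a := 0) (b := 1)
        (fun r => A (r, y) * N (r, y)) t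
    rw [zero_mul, one_mul] at h1
    rw [← h1, ← intervalIntegral.integral_smul]
    simp only [hN]
    rw [volterraSol_eq, ContinuousMap.add_apply, ContinuousMap.one_apply, volterra_apply]
    congr 1
    refine intervalIntegral.integral_congr fun r hr => ?_
    change r ∈ uIcc (0 : ℝ) 1 at hr
    rw [uIcc_of_le zero_le_one] at hr
    simp only [projIcc_of_mem _ hr]
    rw [hG (t, y) ⟨ht, hy⟩, hscale t ht y hy, ← smul_mul_assoc]
  have hcont : ∀ y ∈ U, ContinuousOn (fun r => A (r, y) * N (r, y)) J := fun y hy =>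
    (hA.continuousOn.comp (by fun_prop : Continuous fun r : ℝ => (r, y)).continuousOn
      fun r hr => ⟨hr, hy⟩).mul
    (hNd.continuousOn.comp (by fun_prop : Continuous fun r : ℝ => (r, y)).continuousOn
      fun r hr => ⟨hr, hy⟩)
  refine ⟨N, hNd, fun y hy => by rw [hint 0 hJ0 y hy]; simp, fun t ht y hy => ?_⟩
  exact ((hasDerivWithinAt_integral hJ hJ0 (hcont y hy) ht).const_add 1).congr
    (fun s hs => hint s hs y hy) (hint t ht y hy)

end LinearODE

end

section

open Filter Topology

/-! ### Smooth families of transports -/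

theorem hasDerivWithinAt_clm_apply_const {F G : Type*} [NormedAddCommGroup F] [NormedSpace ℝ F]
    [NormedAddCommGroup G] [NormedSpace ℝ G] (L : F →L[ℝ] G) {f : ℝ → F} {f' : F} {J : Set ℝ}
    {t : ℝ} (h : HasDerivWithinAt f f' J t) :
    HasDerivWithinAt (fun s => L (f s)) (L f') J t :=
  L.hasFDerivAt.comp_hasDerivWithinAt t h

/-- The pull-back of a bilinear form by an endomorphism. -/
def pullBilin (e : E7 →L[ℝ] E7) (k : E7 →L[ℝ] E7 →L[ℝ] ℝ) : E7 →L[ℝ] E7 →L[ℝ] ℝ :=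
  ((ContinuousLinearMap.compL ℝ E7 E7 ℝ).flip e) ∘L k ∘L e

theorem hasDerivWithinAt_pullBilin (e : E7 →L[ℝ] E7) {k : ℝ → E7 →L[ℝ] E7 →L[ℝ] ℝ}
    {k' : E7 →L[ℝ] E7 →L[ℝ] ℝ} {J : Set ℝ} {t : ℝ} (h : HasDerivWithinAt k k' J t) :
    HasDerivWithinAt (fun s => pullBilin e (k s)) (pullBilin e k') J t := by
  have h2 := hasDerivWithinAt_clm_apply_const (F := E7 →L[ℝ] E7 →L[ℝ] ℝ)
    (G := E7 →L[ℝ] E7 →L[ℝ] ℝ) ((ContinuousLinearMap.compL ℝ E7 E7 (E7 →L[ℝ] ℝ)).flip e) h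
  exact hasDerivWithinAt_clm_apply_const (F := E7 →L[ℝ] E7 →L[ℝ] ℝ) (G := E7 →L[ℝ] E7 →L[ℝ] ℝ)
    (ContinuousLinearMap.compL ℝ E7 (E7 →L[ℝ] ℝ) (E7 →L[ℝ] ℝ)
      ((ContinuousLinearMap.compL ℝ E7 E7 ℝ).flip e)) h2

theorem pullBilin_apply (e : E7 →L[ℝ] E7) (k : E7 →L[ℝ] E7 →L[ℝ] ℝ) (u v : E7) :
    pullBilin e k u v = k (e u) (e v) := rfl

section

variable {J : Set ℝ} {k k' : ℝ → E7 →L[ℝ] E7 →L[ℝ] ℝ} {N : ℝ → E7 →L[ℝ] E7}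

theorem IsInner.pullBilin {k : E7 →L[ℝ] E7 →L[ℝ] ℝ} (hk : IsInner k) (e : E7 ≃L[ℝ] E7) :
    IsInner (pullBilin (e : E7 →L[ℝ] E7) k) where
  symm u v := hk.symm _ _
  pos u hu := hk.pos _ (by simpa using hu)

theorem IsInner.halfRaise_pullBilin {k : E7 →L[ℝ] E7 →L[ℝ] ℝ} (hk : IsInner k)
    (k' : E7 →L[ℝ] E7 →L[ℝ] ℝ) (e : E7 ≃L[ℝ] E7) (u : E7) :
    halfRaise (G2.pullBilin (e : E7 →L[ℝ] E7) k) (G2.pullBilin (e : E7 →L[ℝ] E7) k') u =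
      e.symm (halfRaise k k' (e u)) := by
  refine (hk.pullBilin e).eq_of_forall fun v => ?_
  rw [(hk.pullBilin e).halfRaise_apply, pullBilin_apply, pullBilin_apply]
  simp [hk.halfRaise_apply]

theorem IsInnerCurve.pullBilin (hk : IsInnerCurve J k k') (e : E7 ≃L[ℝ] E7) :
    IsInnerCurve J (fun t => pullBilin (e : E7 →L[ℝ] E7) (k t))
      (fun t => G2.pullBilin (e : E7 →L[ℝ] E7) (k' t)) where
  isInner t ht := (hk.isInner t ht).pullBilin e
  hasDeriv t ht := hasDerivWithinAt_pullBilin _ (hk.hasDeriv t ht)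
  symm t ht _ _ := hk.symm t ht _ _

theorem IsTransport.pullBilin (hk : IsInnerCurve J k k') (hN : IsTransport J k k' N)
    (e : E7 ≃L[ℝ] E7) :
    IsTransport J (fun t => pullBilin (e : E7 →L[ℝ] E7) (k t))
      (fun t => G2.pullBilin (e : E7 →L[ℝ] E7) (k' t))
      (fun t => (e.symm : E7 →L[ℝ] E7) ∘L N t ∘L (e : E7 →L[ℝ] E7)) where
  initial := by
    ext1 v
    simp [hN.initial]
  hasDeriv t ht := by
    have h1 := (hasDerivWithinAt_const t J (e.symm : E7 →L[ℝ] E7)).clm_comp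
      ((hN.hasDeriv t ht).clm_comp (hasDerivWithinAt_const t J (e : E7 →L[ℝ] E7)))
    refine h1.congr_deriv ?_
    ext1 v
    have := (hk.isInner t ht).halfRaise_pullBilin (k' t) e
    simp [this]

end

/-- The velocity of a curve of inner products is symmetric. -/
theorem isInnerCurve_of_hasDerivWithinAt {J : Set ℝ} (hJu : UniqueDiffOn ℝ J)
    {k k' : ℝ → E7 →L[ℝ] E7 →L[ℝ] ℝ} (hk : ∀ t ∈ J, HasDerivWithinAt k (k' t) J t)
    (hi : ∀ t ∈ J, IsInner (k t)) : IsInnerCurve J k k' where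
  isInner := hi
  hasDeriv := hk
  symm t ht u v := by
    have h (a b : E7) := hasDerivWithinAt_inner_apply (hk t ht)
      (hasDerivWithinAt_const t J a) (hasDerivWithinAt_const t J b)
    have h1 := (h u v).congr (f₁ := fun s => k s v u) (fun s hs => (hi s hs).symm v u)
      ((hi t ht).symm v u)
    have := (hJu t ht).eq_deriv J h1 (h v u)
    simpa using this

theorem hasDerivWithinAt_prod_left {E F : Type*} [NormedAddCommGroup E] [NormedSpace ℝ E]
    [NormedAddCommGroup F] [NormedSpace ℝ F] {f : ℝ × E → F} {J : Set ℝ} {U : Set E} {t : ℝ} {y : E}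
    (h : DifferentiableWithinAt ℝ f (J ×ˢ U) (t, y)) (hy : y ∈ U) :
    HasDerivWithinAt (fun s => f (s, y)) (fderivWithin ℝ f (J ×ˢ U) (t, y) (1, 0)) J t := by
  have h2 : HasDerivWithinAt (fun s : ℝ => (s, y)) ((1 : ℝ), (0 : E)) J t :=
    (hasDerivWithinAt_id t J).prodMk (hasDerivWithinAt_const t J y)
  have hm : MapsTo (fun s : ℝ => (s, y)) J (J ×ˢ U) := fun s hs => ⟨hs, hy⟩
  exact HasFDerivWithinAt.comp_hasDerivWithinAt t h.hasFDerivWithinAt h2 hm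

/-- A smooth family of inner products depending on time and a parameter has a smooth family of
transports. -/
theorem exists_smooth_transport {J : Set ℝ} (hJ : J.OrdConnected) (hJ0 : (0 : ℝ) ∈ J)
    (hJu : UniqueDiffOn ℝ J) {U : Set E7} (hU : Convex ℝ U) (hUo : IsOpen U)
    {k : ℝ × E7 → E7 →L[ℝ] E7 →L[ℝ] ℝ} (hk : ContDiffOn ℝ ∞ k (J ×ˢ U))
    (hi : ∀ t ∈ J, ∀ y ∈ U, IsInner (k (t, y))) :
    ∃ (k' : ℝ × E7 → E7 →L[ℝ] E7 →L[ℝ] ℝ) (N : ℝ × E7 → E7 →L[ℝ] E7),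
      ContDiffOn ℝ ∞ N (J ×ˢ U) ∧ ∀ y ∈ U,
        IsInnerCurve J (fun t => k (t, y)) (fun t => k' (t, y)) ∧
        IsTransport J (fun t => k (t, y)) (fun t => k' (t, y)) (fun t => N (t, y)) := by
  have hS : UniqueDiffOn ℝ (J ×ˢ U) := hJu.prod hUo.uniqueDiffOn
  set k' : ℝ × E7 → E7 →L[ℝ] E7 →L[ℝ] ℝ := fun p => fderivWithin ℝ k (J ×ˢ U) p (1, 0) with hk'
  have hk'd : ContDiffOn ℝ ∞ k' (J ×ˢ U) :=
    (hk.fderivWithin hS (by simp)).clm_apply contDiffOn_const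
  have hder : ∀ t ∈ J, ∀ y ∈ U, HasDerivWithinAt (fun s => k (s, y)) (k' (t, y)) J t := by
    intro t ht y hy
    exact hasDerivWithinAt_prod_left (F := E7 →L[ℝ] E7 →L[ℝ] ℝ)
      (hk.differentiableOn (by simp) (t, y) ⟨ht, hy⟩) hy
  have hA : ContDiffOn ℝ ∞ (fun p => -halfRaise (k p) (k' p)) (J ×ˢ U) := by
    have hinv : ContDiffOn ℝ ∞ (fun p => (k p).inverse) (J ×ˢ U) := fun p hp =>
      ((hi p.1 hp.1 p.2 hp.2).isInvertible.contDiffAt_map_inverse).comp_contDiffWithinAt p (hk p hp)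
    exact ((hinv.clm_comp hk'd).const_smul (1 / 2 : ℝ)).neg
  obtain ⟨N, hN, hN0, hNd⟩ := exists_linear_ode (R := E7 →L[ℝ] E7) hJ hJ0 hJu hU hUo hA
  refine ⟨k', N, hN, fun y hy => ⟨isInnerCurve_of_hasDerivWithinAt hJu
    (fun t ht => hder t ht y hy) fun t ht => hi t ht y hy, hN0 y hy, fun t ht => ?_⟩⟩
  exact HasDerivWithinAt.congr_deriv (F := E7 →L[ℝ] E7) (hNd t ht y hy) rfl

/-! ### Coordinates on the manifold -/

section

variable {M : Type*} [TopologicalSpace M] [ChartedSpace E7 M] [IsManifold (𝓡 7) ∞ M]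

/-- The linear isomorphism of `T_xM` with `ℝ⁷` given by the chart at `x₀`. -/
def coordEquiv (x₀ x : M) (hx : x ∈ (chartAt E7 x₀).source) : E7 ≃L[ℝ] E7 :=
  (trivializationAt E7 (TangentSpace (𝓡 7)) x₀).continuousLinearEquivAt ℝ x hx

/-- The curve of inner products at the point `x` given by a curve of metrics. The tangent space is
regarded as `ℝ⁷` by definitional unfolding, which amounts to the preferred chart at `x`. -/
def metricAt (g : ℝ → Metric M) (x : M) (t : ℝ) : E7 →L[ℝ] E7 →L[ℝ] ℝ := (g t).inner x

theorem isInner_metricAt (g : ℝ → Metric M) (x : M) (t : ℝ) : IsInner (metricAt g x t) where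
  symm := (g t).symm x
  pos := (g t).pos x

/-- The curve of metrics in the coordinates given by the chart at `x₀`. -/
def coordMetric (g : ℝ → Metric M) (x₀ : M) (p : ℝ × M) : E7 →L[ℝ] E7 →L[ℝ] ℝ :=
  (trivializationAt (E7 →L[ℝ] E7 →L[ℝ] ℝ) (fun x : M =>
    TangentSpace (𝓡 7) x →L[ℝ] TangentSpace (𝓡 7) x →L[ℝ] Bundle.Trivial M ℝ x) x₀
      ⟨p.2, (g p.1).inner p.2⟩).2

theorem coordMetric_eq (g : ℝ → Metric M) {x₀ x : M} (hx : x ∈ (chartAt E7 x₀).source) (t : ℝ) :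
    coordMetric g x₀ (t, x) =
      pullBilin ((coordEquiv x₀ x hx).symm : E7 →L[ℝ] E7) (metricAt g x t) := by
  ext u v
  rw [coordMetric, hom_trivializationAt_apply, pullBilin_apply]
  have := inCoordinates_apply_eq₂ (𝕜 := ℝ) (F₁ := E7) (F₂ := E7) (F₃ := ℝ)
    (E₁ := fun x : M => TangentSpace (𝓡 7) x) (E₂ := fun x : M => TangentSpace (𝓡 7) x)
    (E₃ := Bundle.Trivial M ℝ) (x₀ := x₀) (x := x) (ϕ := (g t).inner x) (v := u) (w := v)
    hx hx (mem_univ _)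
  refine this.trans ?_
  have hid : (trivializationAt ℝ (Bundle.Trivial M ℝ) x₀).linearMapAt ℝ x = LinearMap.id :=
    Bundle.Trivial.linearMapAt_trivialization ℝ M ℝ x
  rw [hid]
  rfl

theorem contMDiffOn_coordMetric {I : Set ℝ} {g : ℝ → Metric M} (hg : IsSmoothMetricCurve I g)
    (x₀ : M) : ContMDiffOn ((𝓘(ℝ, ℝ)).prod (𝓡 7)) 𝓘(ℝ, E7 →L[ℝ] E7 →L[ℝ] ℝ) ∞ (coordMetric g x₀)
      (I ×ˢ (chartAt E7 x₀).source) := by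
  have h := hg.mono (prod_mono_right (subset_univ (chartAt E7 x₀).source))
  let e := trivializationAt (E7 →L[ℝ] E7 →L[ℝ] ℝ) (fun x : M =>
      TangentSpace (𝓡 7) x →L[ℝ] TangentSpace (𝓡 7) x →L[ℝ] Bundle.Trivial M ℝ x) x₀
  have he : MapsTo (fun p : ℝ × M => Bundle.TotalSpace.mk' (E7 →L[ℝ] E7 →L[ℝ] ℝ)
      (E := fun x : M =>
        TangentSpace (𝓡 7) x →L[ℝ] TangentSpace (𝓡 7) x →L[ℝ] Bundle.Trivial M ℝ x)
      p.2 ((g p.1).inner p.2)) (I ×ˢ (chartAt E7 x₀).source) e.source := by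
    rintro ⟨t, x⟩ ⟨-, hx⟩
    rw [Bundle.Trivialization.mem_source]
    exact ⟨hx, hx, mem_univ _⟩
  have hadd : ∀ x : M, ContinuousAdd (TangentSpace (𝓡 7) x →L[ℝ] Bundle.Trivial M ℝ x) :=
    fun x => inferInstance
  have h2 := (e.contMDiffOn_iff (IB := 𝓡 7) he).1 h
  exact h2.2

theorem contDiffOn_coordMetric {I : Set ℝ} {g : ℝ → Metric M} (hg : IsSmoothMetricCurve I g)
    (x₀ : M) : ContDiffOn ℝ ∞
      (fun p : ℝ × E7 => coordMetric g x₀ (p.1, (extChartAt (𝓡 7) x₀).symm p.2))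
      (I ×ˢ (extChartAt (𝓡 7) x₀).target) := by
  rw [← contMDiffOn_iff_contDiffOn]
  have h1 : ContMDiffOn 𝓘(ℝ, ℝ × E7) ((𝓘(ℝ, ℝ)).prod (𝓡 7)) ∞
      (fun p : ℝ × E7 => (p.1, (extChartAt (𝓡 7) x₀).symm p.2))
      (I ×ˢ (extChartAt (𝓡 7) x₀).target) := contDiff_fst.contMDiff.contMDiffOn.prodMk
    ((contMDiffOn_extChartAt_symm x₀).comp contDiff_snd.contMDiff.contMDiffOn fun p hp => hp.2)
  refine (contMDiffOn_coordMetric hg x₀).comp h1 ?_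
  rintro ⟨t, y⟩ ⟨ht, hy⟩
  refine ⟨ht, ?_⟩
  rw [← extChartAt_source (𝓡 7)]
  exact (extChartAt (𝓡 7) x₀).map_target hy

/-- The velocity of a curve of metrics at the point `x`. -/
def velocityAt (I : Set ℝ) (g : ℝ → Metric M) (x : M) (t : ℝ) : E7 →L[ℝ] E7 →L[ℝ] ℝ :=
  velocity I g t x

theorem metricAt_eq (g : ℝ → Metric M) {x₀ x : M} (hx : x ∈ (chartAt E7 x₀).source) (t : ℝ) :
    metricAt g x t = pullBilin (coordEquiv x₀ x hx : E7 →L[ℝ] E7) (coordMetric g x₀ (t, x)) := by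
  rw [coordMetric_eq g hx]
  ext u v
  simp [pullBilin_apply]

theorem velocityAt_eq {I : Set ℝ} (hIu : UniqueDiffOn ℝ I) {g : ℝ → Metric M} {x : M} {t : ℝ}
    (ht : t ∈ I) {k' : E7 →L[ℝ] E7 →L[ℝ] ℝ} (h : HasDerivWithinAt (metricAt g x) k' I t) :
    velocityAt I g x t = k' :=
  HasDerivWithinAt.derivWithin (F := E7 →L[ℝ] E7 →L[ℝ] ℝ) h (hIu t ht)

/-- Near every point, the transports of a smooth curve of metrics exist and depend smoothly on the
point. -/
theorem exists_local_transport {I : Set ℝ} (hI : I.OrdConnected) (hI0 : (0 : ℝ) ∈ I)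
    (hIu : UniqueDiffOn ℝ I) {g : ℝ → Metric M} (hg : IsSmoothMetricCurve I g) (x₀ : M) :
    ∃ (N : ℝ × E7 → E7 →L[ℝ] E7) (U : Set E7), IsOpen U ∧ extChartAt (𝓡 7) x₀ x₀ ∈ U ∧
      ContDiffOn ℝ ∞ N (I ×ˢ U) ∧
      ∀ x (hx : x ∈ (chartAt E7 x₀).source), extChartAt (𝓡 7) x₀ x ∈ U →
        IsInnerCurve I (metricAt g x) (velocityAt I g x) ∧
        IsTransport I (metricAt g x) (velocityAt I g x) (fun t =>
          ((coordEquiv x₀ x hx).symm : E7 →L[ℝ] E7) ∘L N (t, extChartAt (𝓡 7) x₀ x) ∘L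
            (coordEquiv x₀ x hx : E7 →L[ℝ] E7)) := by
  obtain ⟨r, hr, hrU⟩ := Metric.isOpen_iff.1 (isOpen_extChartAt_target (I := 𝓡 7) x₀)
    _ (mem_extChartAt_target x₀)
  set U := Metric.ball (extChartAt (𝓡 7) x₀ x₀) r with hU
  have hmem : ∀ y ∈ U, (extChartAt (𝓡 7) x₀).symm y ∈ (chartAt E7 x₀).source := fun y hy => by
    rw [← extChartAt_source (𝓡 7)]
    exact (extChartAt (𝓡 7) x₀).map_target (hrU hy)
  obtain ⟨k', N, hN, h⟩ := exists_smooth_transport hI hI0 hIu (convex_ball _ r) Metric.isOpen_ball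
    ((contDiffOn_coordMetric hg x₀).mono (prod_mono_right hrU)) (fun t _ y hy => by
      rw [coordMetric_eq g (hmem y hy)]
      exact (isInner_metricAt g _ t).pullBilin _)
  refine ⟨N, U, Metric.isOpen_ball, Metric.mem_ball_self hr, hN, fun x hx hxU => ?_⟩
  obtain ⟨hk, hNx⟩ := h _ hxU
  have hxs : (extChartAt (𝓡 7) x₀).symm (extChartAt (𝓡 7) x₀ x) = x :=
    (extChartAt (𝓡 7) x₀).left_inv (by rwa [extChartAt_source])
  simp only [hxs] at hk hNx
  have hk2 := hk.pullBilin (coordEquiv x₀ x hx)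
  have hN2 := hNx.pullBilin hk (coordEquiv x₀ x hx)
  simp only [← metricAt_eq] at hk2 hN2
  have hv : ∀ t ∈ I, pullBilin (coordEquiv x₀ x hx : E7 →L[ℝ] E7)
      (k' (t, extChartAt (𝓡 7) x₀ x)) = velocityAt I g x t := fun t ht =>
    (velocityAt_eq hIu ht (hk2.hasDeriv t ht)).symm
  refine ⟨⟨hk2.isInner, fun t ht => ?_, fun t ht => ?_⟩, hN2.initial, fun t ht => ?_⟩
  · rw [← hv t ht]
    exact hk2.hasDeriv t ht
  · rw [← hv t ht]
    exact hk2.symm t ht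
  · rw [← hv t ht]
    exact hN2.hasDeriv t ht

end

/-! ### Smooth pull-back of three-forms -/

theorem finiteDimensional_multilinear :
    FiniteDimensional ℝ (ContinuousMultilinearMap ℝ (fun _ : Fin 3 => E7) ℝ) :=
  FiniteDimensional.of_injective
    (ContinuousMultilinearMap.toMultilinearMapLinear :
      ContinuousMultilinearMap ℝ (fun _ : Fin 3 => E7) ℝ →ₗ[ℝ] _)
    ContinuousMultilinearMap.toMultilinearMap_injective

/-- Alternating forms are a complemented subspace of the multilinear forms, so that smoothness of a
family of alternating forms may be checked in the multilinear forms. -/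
theorem exists_alternating_retraction :
    ∃ P : ContinuousMultilinearMap ℝ (fun _ : Fin 3 => E7) ℝ →L[ℝ] E7 [⋀^Fin 3]→L[ℝ] ℝ,
      ∀ φ : E7 [⋀^Fin 3]→L[ℝ] ℝ, P φ.toContinuousMultilinearMap = φ := by
  have := finiteDimensional_multilinear
  obtain ⟨P, hP⟩ := (ContinuousAlternatingMap.toContinuousMultilinearMapLinear (R := ℝ) (A := ℝ)
    (M := E7) (N := ℝ) (ι := Fin 3)).exists_leftInverse_of_injective
    (LinearMap.ker_eq_bot.2 ContinuousAlternatingMap.toContinuousMultilinearMap_injective)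
  exact ⟨LinearMap.toContinuousLinearMap P, fun φ => congrArg (fun L => L φ) hP⟩

theorem contDiff_compContinuousLinearMap :
    ContDiff ℝ ∞ fun p : (E7 [⋀^Fin 3]→L[ℝ] ℝ) × (E7 →L[ℝ] E7) =>
      p.1.compContinuousLinearMap p.2 := by
  obtain ⟨P, hP⟩ := exists_alternating_retraction
  have h1 : ContDiff ℝ ∞ fun p : (E7 [⋀^Fin 3]→L[ℝ] ℝ) × (E7 →L[ℝ] E7) =>
      ContinuousMultilinearMap.compContinuousLinearMapContinuousMultilinear ℝ
        (fun _ : Fin 3 => E7) (fun _ : Fin 3 => E7) ℝ fun _ => p.2 :=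
    (ContinuousMultilinearMap.contDiff _).comp (contDiff_pi.2 fun _ => contDiff_snd)
  have h2 : ContDiff ℝ ∞ fun p : (E7 [⋀^Fin 3]→L[ℝ] ℝ) × (E7 →L[ℝ] E7) =>
      p.1.toContinuousMultilinearMap :=
    (ContinuousAlternatingMap.toContinuousMultilinearMapLI (𝕜 := ℝ) (E := E7) (F := ℝ)
      (ι := Fin 3)).contDiff.comp contDiff_fst
  have h3 := P.contDiff.comp (h1.clm_apply h2)
  have h4 : (fun p : (E7 [⋀^Fin 3]→L[ℝ] ℝ) × (E7 →L[ℝ] E7) => p.1.compContinuousLinearMap p.2) =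
      fun p => P (ContinuousMultilinearMap.compContinuousLinearMapContinuousMultilinear ℝ
        (fun _ : Fin 3 => E7) (fun _ : Fin 3 => E7) ℝ (fun _ => p.2)
          p.1.toContinuousMultilinearMap) :=
    funext fun p => (hP (p.1.compContinuousLinearMap p.2)).symm
  rw [h4]
  exact h3

section

variable {M : Type*} [TopologicalSpace M] [ChartedSpace E7 M] [IsManifold (𝓡 7) ∞ M]

/-- A three-form in the coordinates given by the chart at `x₀`. -/
def coordForm (x₀ x : M) (φ : E7 [⋀^Fin 3]→L[ℝ] ℝ) : E7 [⋀^Fin 3]→L[ℝ] ℝ :=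
  (trivializationAt (E7 [⋀^Fin 3]→L[ℝ] ℝ)
    (fun x : M => TangentSpace (𝓡 7) x [⋀^Fin 3]→L[ℝ] Bundle.Trivial M ℝ x) x₀ ⟨x, φ⟩).2

theorem coordForm_comp {x₀ x : M} (hx : x ∈ (chartAt E7 x₀).source)
    (φ : E7 [⋀^Fin 3]→L[ℝ] ℝ) (P : E7 →L[ℝ] E7) :
    coordForm x₀ x (φ.compContinuousLinearMap P) = (coordForm x₀ x φ).compContinuousLinearMap
      ((coordEquiv x₀ x hx : E7 →L[ℝ] E7) ∘L P ∘L ((coordEquiv x₀ x hx).symm : E7 →L[ℝ] E7)) := by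
  have h (ψ : E7 [⋀^Fin 3]→L[ℝ] ℝ) (v : Fin 3 → E7) : coordForm x₀ x ψ v =
      (trivializationAt ℝ (Bundle.Trivial M ℝ) x₀).continuousLinearMapAt ℝ x
        (ψ fun i => (coordEquiv x₀ x hx).symm (v i)) := by
    have hs : ∀ u, (coordEquiv x₀ x hx).symm u =
        (trivializationAt E7 (TangentSpace (𝓡 7)) x₀).symmL ℝ x u := fun u =>
      congrFun (Bundle.Trivialization.symm_continuousLinearEquivAt_eq _ hx) u
    simp only [hs]
    rfl
  ext v
  rw [h, ContinuousAlternatingMap.compContinuousLinearMap_apply,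
    ContinuousAlternatingMap.compContinuousLinearMap_apply, h]
  simp [Function.comp_def]

end

/-! ### The solution on the manifold -/

theorem isInvertible_conj {A : E7 →L[ℝ] E7} (hA : A.IsInvertible) (e : E7 ≃L[ℝ] E7) :
    ((e.symm : E7 →L[ℝ] E7) ∘L A ∘L (e : E7 →L[ℝ] E7)).IsInvertible := by
  obtain ⟨a, rfl⟩ := hA
  exact ⟨(e.trans a).trans e.symm, rfl⟩

theorem inverse_conj {A : E7 →L[ℝ] E7} (hA : A.IsInvertible) (e : E7 ≃L[ℝ] E7) :
    ((e.symm : E7 →L[ℝ] E7) ∘L A ∘L (e : E7 →L[ℝ] E7)).inverse =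
      (e.symm : E7 →L[ℝ] E7) ∘L A.inverse ∘L (e : E7 →L[ℝ] E7) := by
  obtain ⟨a, rfl⟩ := hA
  have : (e.symm : E7 →L[ℝ] E7) ∘L (a : E7 →L[ℝ] E7) ∘L (e : E7 →L[ℝ] E7) =
    ((e.trans a).trans e.symm : E7 ≃L[ℝ] E7) := rfl
  rw [this, ContinuousLinearMap.inverse_equiv, ContinuousLinearMap.inverse_equiv]
  rfl

theorem uniqueDiffOn_of_ordConnected {J : Set ℝ} (hJ : J.OrdConnected) (h : J.Nontrivial) :
    UniqueDiffOn ℝ J :=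
  uniqueDiffOn_convex hJ.convex (hJ.convex.nontrivial_iff_nonempty_interior.1 h)

section

variable {M : Type*} [TopologicalSpace M] [ChartedSpace E7 M] [IsManifold (𝓡 7) ∞ M]

/-- The three-form of a field at the point `x`. -/
def formAt (φ : FormField M) (x : M) : E7 [⋀^Fin 3]→L[ℝ] ℝ := φ x

theorem isInnerCurve_metricAt {I : Set ℝ} (hI : I.OrdConnected) (hI0 : (0 : ℝ) ∈ I)
    (hIu : UniqueDiffOn ℝ I) {g : ℝ → Metric M} (hg : IsSmoothMetricCurve I g) (x : M) :
    IsInnerCurve I (metricAt g x) (velocityAt I g x) := by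
  obtain ⟨N, U, -, hxU, -, h⟩ := exists_local_transport hI hI0 hIu hg x
  exact (h x (mem_chart_source E7 x) hxU).1

theorem exists_transport {I : Set ℝ} (hI : I.OrdConnected) (hI0 : (0 : ℝ) ∈ I)
    (hIu : UniqueDiffOn ℝ I) {g : ℝ → Metric M} (hg : IsSmoothMetricCurve I g) (x : M) :
    ∃ N, IsTransport I (metricAt g x) (velocityAt I g x) N := by
  obtain ⟨N, U, -, hxU, -, h⟩ := exists_local_transport hI hI0 hIu hg x
  exact ⟨_, (h x (mem_chart_source E7 x) hxU).2⟩

/-- The pull-backs of a smooth positive form by the inverse transports at the points of `M` form a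
smooth curve: near a point the chosen transports are the smooth local ones, by uniqueness. -/
theorem isSmoothFormCurve_comp_inverse {I : Set ℝ} (hI : I.OrdConnected) (hI0 : (0 : ℝ) ∈ I)
    (hIu : UniqueDiffOn ℝ I) {g : ℝ → Metric M} (hg : IsSmoothMetricCurve I g)
    {φ₀ : FormField M} (hφ₀ : φ₀ ∈ PositiveForms M) {N : M → ℝ → E7 →L[ℝ] E7}
    (hN : ∀ x, IsTransport I (metricAt g x) (velocityAt I g x) (N x)) {φ : ℝ → FormField M}
    (hφ : ∀ t x, formAt (φ t) x = (formAt φ₀ x).compContinuousLinearMap (N x t).inverse) :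
    IsSmoothFormCurve I φ := by
  rintro ⟨t₀, x₀⟩ ⟨ht₀, -⟩
  rw [Bundle.contMDiffWithinAt_totalSpace]
  refine ⟨contMDiffWithinAt_snd, ?_⟩
  change ContMDiffWithinAt ((𝓘(ℝ, ℝ)).prod (𝓡 7)) 𝓘(ℝ, E7 [⋀^Fin 3]→L[ℝ] ℝ) ∞
    (fun p : ℝ × M => coordForm x₀ p.2 (formAt (φ p.1) p.2)) (I ×ˢ univ) (t₀, x₀)
  obtain ⟨Nloc, U, hU, hxU, hNl, h⟩ := exists_local_transport hI hI0 hIu hg x₀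
  set V : Set M := {x | x ∈ (chartAt E7 x₀).source ∧ extChartAt (𝓡 7) x₀ x ∈ U} with hV
  have hVx : V ∈ 𝓝 x₀ := inter_mem (chart_source_mem_nhds E7 x₀)
    ((continuousAt_extChartAt x₀).preimage_mem_nhds (hU.mem_nhds hxU))
  have hIV : I ×ˢ V ∈ 𝓝[I ×ˢ univ] (t₀, x₀) := by
    rw [nhdsWithin_prod_eq, nhdsWithin_univ]
    exact prod_mem_prod self_mem_nhdsWithin hVx
  have hloc : ∀ t ∈ I, ∀ x, (hx : x ∈ V) → N x t =
      ((coordEquiv x₀ x hx.1).symm : E7 →L[ℝ] E7) ∘L Nloc (t, extChartAt (𝓡 7) x₀ x) ∘L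
            (coordEquiv x₀ x hx.1 : E7 →L[ℝ] E7) := fun t ht x hx =>
    (hN x).unique hI hI0 (h x hx.1 hx.2).1 (h x hx.1 hx.2).2 ht
  have hloc' : ∀ t ∈ I, ∀ x, (hx : x ∈ V) → Nloc (t, extChartAt (𝓡 7) x₀ x) =
      ((coordEquiv x₀ x hx.1).symm.symm : E7 →L[ℝ] E7) ∘L N x t ∘L
            ((coordEquiv x₀ x hx.1).symm : E7 →L[ℝ] E7) := fun t ht x hx => by
    rw [hloc t ht x hx]
    ext1 v
    simp
  have hinv : ∀ t ∈ I, ∀ x, x ∈ V → (N x t).IsInvertible := fun t ht x hx =>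
    (hN x).isInvertible hI hI0 (h x hx.1 hx.2).1 ht
  have hx₀V : x₀ ∈ V := mem_of_mem_nhds hVx
  have h1 : ContMDiffAt (𝓡 7) 𝓘(ℝ, E7 [⋀^Fin 3]→L[ℝ] ℝ) ∞
      (fun x => coordForm x₀ x (formAt φ₀ x)) x₀ := (Bundle.contMDiffAt_section x₀).1 (hφ₀.1 x₀)
  have h2 : ContMDiffWithinAt ((𝓘(ℝ, ℝ)).prod (𝓡 7)) 𝓘(ℝ, E7 →L[ℝ] E7) ∞
      (fun p : ℝ × M => (Nloc (p.1, extChartAt (𝓡 7) x₀ p.2)).inverse) (I ×ˢ V) (t₀, x₀) := by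
    have hd : ContDiffWithinAt ℝ ∞ (fun q : ℝ × E7 => (Nloc q).inverse) (I ×ˢ U)
        (t₀, extChartAt (𝓡 7) x₀ x₀) := by
      have hi : (Nloc (t₀, extChartAt (𝓡 7) x₀ x₀)).IsInvertible := by
        rw [hloc' t₀ ht₀ x₀ hx₀V]
        exact isInvertible_conj (hinv t₀ ht₀ x₀ hx₀V) _
      exact hi.contDiffAt_map_inverse.comp_contDiffWithinAt _ (hNl _ ⟨ht₀, hxU⟩)
    have hc : ContMDiffWithinAt ((𝓘(ℝ, ℝ)).prod (𝓡 7)) 𝓘(ℝ, ℝ × E7) ∞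
        (fun p : ℝ × M => (p.1, extChartAt (𝓡 7) x₀ p.2)) (I ×ˢ V) (t₀, x₀) :=
      contMDiffWithinAt_fst.prodMk_space
        ((contMDiffAt_extChartAt (I := 𝓡 7) (x := x₀)).comp_contMDiffWithinAt (t₀, x₀)
          contMDiffWithinAt_snd)
    have hm : MapsTo (fun p : ℝ × M => (p.1, extChartAt (𝓡 7) x₀ p.2)) (I ×ˢ V) (I ×ˢ U) :=
      fun p hp => ⟨hp.1, hp.2.2⟩
    exact ContDiffWithinAt.comp_contMDiffWithinAt (x := (t₀, x₀)) hd hc hm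
  have h1' : ContMDiffWithinAt ((𝓘(ℝ, ℝ)).prod (𝓡 7)) 𝓘(ℝ, E7 [⋀^Fin 3]→L[ℝ] ℝ) ∞
      (fun p : ℝ × M => coordForm x₀ p.2 (formAt φ₀ p.2)) (I ×ˢ V) (t₀, x₀) :=
    ContMDiffAt.comp_contMDiffWithinAt (x := (t₀, x₀))
      (g := fun x => coordForm x₀ x (formAt φ₀ x)) h1 contMDiffWithinAt_snd
  have h3 : ContMDiffWithinAt ((𝓘(ℝ, ℝ)).prod (𝓡 7)) 𝓘(ℝ, E7 [⋀^Fin 3]→L[ℝ] ℝ) ∞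
      (fun p : ℝ × M => (coordForm x₀ p.2 (formAt φ₀ p.2)).compContinuousLinearMap
        (Nloc (p.1, extChartAt (𝓡 7) x₀ p.2)).inverse) (I ×ˢ V) (t₀, x₀) :=
    ContDiffAt.comp_contMDiffWithinAt (x := (t₀, x₀)) contDiff_compContinuousLinearMap.contDiffAt
      (h1'.prodMk_space h2)
  have heq : ∀ p ∈ I ×ˢ V, coordForm x₀ p.2 (formAt (φ p.1) p.2) =
      (coordForm x₀ p.2 (formAt φ₀ p.2)).compContinuousLinearMap
        (Nloc (p.1, extChartAt (𝓡 7) x₀ p.2)).inverse := by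
    rintro ⟨t, x⟩ ⟨ht, hx⟩
    simp only
    rw [hloc' t ht x hx, inverse_conj (hinv t ht x hx), hφ]
    exact coordForm_comp hx.1 _ _
  exact (h3.congr heq (heq _ ⟨ht₀, hx₀V⟩)).mono_of_mem_nhdsWithin hIV

theorem IsSolution.isFormSolution {J : Set ℝ} {g : ℝ → Metric M} {φ₀ : FormField M}
    {η : ℝ → FormField M} (h : IsSolution J g φ₀ η) (x : M) :
    IsFormSolution J (velocityAt J g x) (fun t => formAt (η t) x) where
  positive t ht := (h.mem_positive t ht).2 x
  hasDeriv t ht := h.ode t ht x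

/-- A solution is the pull-back of the initial form by the inverse transports. -/
theorem IsSolution.eq_comp_inverse {J : Set ℝ} (hJ : J.OrdConnected) (hJ0 : (0 : ℝ) ∈ J)
    {g : ℝ → Metric M} {φ₀ : FormField M} {η : ℝ → FormField M} (h : IsSolution J g φ₀ η)
    (hg0 : Induces φ₀ (g 0)) {x : M} (hk : IsInnerCurve J (metricAt g x) (velocityAt J g x))
    {N : ℝ → E7 →L[ℝ] E7} (hN : IsTransport J (metricAt g x) (velocityAt J g x) N) {t : ℝ}
    (ht : t ∈ J) : formAt (η t) x = (formAt φ₀ x).compContinuousLinearMap (N t).inverse := by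
  have h0 : inducedMetric (formAt (η 0) x) = metricAt g x 0 := by
    rw [h.initial]
    exact hg0 x
  have := (h.isFormSolution x).eq_comp_inverse hJ hJ0 hk h0 hN ht
  rwa [h.initial] at this

theorem IsSolution.induces {J : Set ℝ} (hJ : J.OrdConnected) (hJ0 : (0 : ℝ) ∈ J)
    (hJu : UniqueDiffOn ℝ J) {g : ℝ → Metric M} (hg : IsSmoothMetricCurve J g)
    {φ₀ : FormField M} {η : ℝ → FormField M} (h : IsSolution J g φ₀ η)
    (hg0 : Induces φ₀ (g 0)) {t : ℝ} (ht : t ∈ J) : Induces (η t) (g t) := fun x => by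
  have h0 : inducedMetric (formAt (η 0) x) = metricAt g x 0 := by
    rw [h.initial]
    exact hg0 x
  exact (h.isFormSolution x).inducedMetric_eq hJ hJ0 (isInnerCurve_metricAt hJ hJ0 hJu hg x) h0 ht

theorem exists_isSolution {I : Set ℝ} (hI : I.OrdConnected) (hI0 : (0 : ℝ) ∈ I)
    (hIu : UniqueDiffOn ℝ I) {g : ℝ → Metric M} (hg : IsSmoothMetricCurve I g)
    {φ₀ : FormField M} (hφ₀ : φ₀ ∈ PositiveForms M) (hg0 : Induces φ₀ (g 0)) :
    ∃ φ, IsSolution I g φ₀ φ := by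
  choose N hN using exists_transport hI hI0 hIu hg
  let φ : ℝ → FormField M := fun t x => (formAt φ₀ x).compContinuousLinearMap (N x t).inverse
  have hsm : IsSmoothFormCurve I φ :=
    isSmoothFormCurve_comp_inverse hI hI0 hIu hg hφ₀ hN fun t x => rfl
  have hsol (x : M) : IsFormSolution I (velocityAt I g x) (fun t => formAt (φ t) x) :=
    (hN x).isFormSolution hI hI0 (isInnerCurve_metricAt hI hI0 hIu hg x) (hφ₀.2 x) (hg0 x)
  refine ⟨φ, hsm, fun t ht => ⟨?_, fun x => (hsol x).positive t ht⟩, ?_,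
    fun t ht x => (hsol x).hasDeriv t ht⟩
  · exact hsm.comp_contMDiff (contMDiff_const.prodMk contMDiff_id) fun x => ⟨ht, mem_univ _⟩
  · funext x
    change (formAt φ₀ x).compContinuousLinearMap (N x 0).inverse = formAt φ₀ x
    rw [(hN x).initial, ContinuousLinearMap.inverse_id]
    rfl

/-- On the degenerate interval the constant curve is a solution. -/
theorem isSolution_const {I : Set ℝ} (hI : I.Subsingleton) {g : ℝ → Metric M} {φ₀ : FormField M}
    (hφ₀ : φ₀ ∈ PositiveForms M) : IsSolution I g φ₀ fun _ => φ₀ where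
  smooth := (hφ₀.1.comp contMDiff_snd).contMDiffOn
  mem_positive _ _ := hφ₀
  initial := rfl
  ode _ _ _ := HasFDerivWithinAt.of_subsingleton hI

theorem IsSolution.unique {I J : Set ℝ} (hI : I.OrdConnected) (hI0 : (0 : ℝ) ∈ I) (hJI : J ⊆ I)
    (hJ : J.OrdConnected) (hJ0 : (0 : ℝ) ∈ J) {g : ℝ → Metric M} (hg : IsSmoothMetricCurve I g)
    {φ₀ : FormField M} {φ η : ℝ → FormField M} (hg0 : Induces φ₀ (g 0))
    (hφ : IsSolution I g φ₀ φ) (hη : IsSolution J g φ₀ η) {t : ℝ} (ht : t ∈ J) : η t = φ t := by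
  rcases J.subsingleton_or_nontrivial with hJs | hJn
  · rw [hJs ht hJ0, hη.initial, hφ.initial]
  have hJu := uniqueDiffOn_of_ordConnected hJ hJn
  have hIu := uniqueDiffOn_of_ordConnected hI (hJn.mono hJI)
  funext x
  obtain ⟨N, hN⟩ := exists_transport hI hI0 hIu hg x
  have hk := isInnerCurve_metricAt hI hI0 hIu hg x
  have hv : ∀ s ∈ J, velocityAt J g x s = velocityAt I g x s := fun s hs =>
    velocityAt_eq hJu hs ((hk.mono hJI).hasDeriv s hs)
  have hkJ : IsInnerCurve J (metricAt g x) (velocityAt J g x) :=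
    isInnerCurve_metricAt hJ hJ0 hJu (hg.mono (prod_mono_left hJI)) x
  have hNJ : IsTransport J (metricAt g x) (velocityAt J g x) N :=
    ⟨hN.initial, fun s hs => by
      rw [hv s hs]
      exact (hN.mono hJI).hasDeriv s hs⟩
  exact (hη.eq_comp_inverse hJ hJ0 hg0 hkJ hNJ ht).trans
    (hφ.eq_comp_inverse hI hI0 hg0 hk hN (hJI ht)).symm

/-- Under the commutation condition the transports are the square roots `B_{g_t}^{g_0}`, so that the
solution at time `t` is determined by the metrics at the times `0` and `t`. -/
theorem IsSolution.eq_comp_metricRoot {I : Set ℝ} (hI : I.OrdConnected) (hI0 : (0 : ℝ) ∈ I)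
    (hIu : UniqueDiffOn ℝ I) {g : ℝ → Metric M} (hg : IsSmoothMetricCurve I g)
    (hflat : IsPointwiseFlat I g) {φ₀ : FormField M} {φ : ℝ → FormField M}
    (hg0 : Induces φ₀ (g 0)) (hφ : IsSolution I g φ₀ φ) {t : ℝ} (ht : t ∈ I) (x : M) :
    formAt (φ t) x = (formAt φ₀ x).compContinuousLinearMap
      (metricRoot (metricAt g x 0) (metricAt g x t)).inverse := by
  have hk := isInnerCurve_metricAt hI hI0 hIu hg x
  refine hφ.eq_comp_inverse hI hI0 hg0 hk
    (N := fun t => metricRoot (metricAt g x 0) (metricAt g x t))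
    (hk.isTransport_metricRoot hIu hI0 (fun s hs => ?_) fun s hs r hr => hflat s hs r hr x) ht
  obtain ⟨f, -, hf⟩ := ((hφ.isFormSolution x).positive s hs).isCompatible
  have hind : inducedMetric (formAt (φ s) x) = metricAt g x s := hφ.induces hI hI0 hIu hg hg0 hs x
  rw [hind] at hf
  exact isMetricRoot_metricRoot (hk.isInner 0 hI0) hf

end

end

end G2

end

theorem mainTheorem11 {M : Type*} [TopologicalSpace M] [ChartedSpace G2.E7 M]
    [IsManifold (𝓡 7) ∞ M]
    (φ₀ : G2.FormField M) (hφ₀ : φ₀ ∈ G2.PositiveForms M)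
    (I : Set ℝ) (hI : I.OrdConnected) (hI0 : (0 : ℝ) ∈ I)
    (g : ℝ → G2.Metric M) (hg : G2.IsSmoothMetricCurve I g) (hg0 : G2.Induces φ₀ (g 0)) :
    (∃ φ : ℝ → G2.FormField M, G2.IsSolution I g φ₀ φ ∧
      (∀ t ∈ I, φ t ∈ G2.PositiveForms M ∧ G2.Induces (φ t) (g t)) ∧
      ∀ J ⊆ I, J.OrdConnected → (0 : ℝ) ∈ J → ∀ η : ℝ → G2.FormField M,
        G2.IsSolution J g φ₀ η → ∀ t ∈ J, η t = φ t) ∧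
    (G2.IsPointwiseFlat I g → ∀ τ ∈ I, ∀ I' : Set ℝ, I'.OrdConnected → (0 : ℝ) ∈ I' → τ ∈ I' →
      ∀ g' : ℝ → G2.Metric M, G2.IsSmoothMetricCurve I' g' → G2.IsPointwiseFlat I' g' →
        g' 0 = g 0 → g' τ = g τ →
        ∀ φ φ' : ℝ → G2.FormField M, G2.IsSolution I g φ₀ φ → G2.IsSolution I' g' φ₀ φ' →
          φ τ = φ' τ) := by
  refine ⟨?_, ?_⟩
  · obtain ⟨φ, hφ, hind⟩ : ∃ φ, G2.IsSolution I g φ₀ φ ∧ ∀ t ∈ I, G2.Induces (φ t) (g t) := by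
      rcases I.subsingleton_or_nontrivial with hIs | hIn
      · refine ⟨_, G2.isSolution_const hIs hφ₀, fun t ht => ?_⟩
        rw [hIs ht hI0]
        exact hg0
      · have hIu := G2.uniqueDiffOn_of_ordConnected hI hIn
        obtain ⟨φ, hφ⟩ := G2.exists_isSolution hI hI0 hIu hg hφ₀ hg0
        exact ⟨φ, hφ, fun t ht => hφ.induces hI hI0 hIu hg hg0 ht⟩
    exact ⟨φ, hφ, fun t ht => ⟨hφ.mem_positive t ht, hind t ht⟩,
      fun J hJI hJ hJ0 η hη t ht => hφ.unique hI hI0 hJI hJ hJ0 hg hg0 hη ht⟩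
  · intro hflat τ hτ I' hI' hI0' hτ' g' hg' hflat' h0 hτg φ φ' hφ hφ'
    rcases eq_or_ne τ 0 with rfl | hne
    · rw [hφ.initial, hφ'.initial]
    have hIu := G2.uniqueDiffOn_of_ordConnected hI ⟨τ, hτ, 0, hI0, hne⟩
    have hIu' := G2.uniqueDiffOn_of_ordConnected hI' ⟨τ, hτ', 0, hI0', hne⟩
    have hg0' : G2.Induces φ₀ (g' 0) := h0 ▸ hg0
    funext x
    have h1 := hφ.eq_comp_metricRoot hI hI0 hIu hg hflat hg0 hτ x
    have h2 := hφ'.eq_comp_metricRoot hI' hI0' hIu' hg' hflat' hg0' hτ' x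
    simp only [G2.metricAt, h0, hτg] at h1 h2
    exact h1.trans h2.symm
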